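/- A frequency is a strictly increasing sequence $\lambda=(\lambda_n)_{n\ge 1}$ of nonnegative real numbers tending to $+\infty$. A $\lambda$-Dirichlet polynomial is a finite sum $D(s)=\sum_{n=1}^M a_n e^{-\lambda_n s}$ with $a_n\in\mathbb C$; it has length $N$ if $a_n=0$ for all $n>N$. For $p\in[1,+\infty)$ put $$\|D\|_p=\Big(\lim_{T\to+\infty}\frac1{2T}\int_{-T}^{T}|D(it)|^p\,dt\Big)^{1/p}.$$ Let $\mathcal H_1(\lambda)$ be the completion of the space of $\lambda$-Dirichlet polynomials for $\|\cdot\|_1$. The coefficient maps $D\mapsto a_n$ extend continuously to $\mathcal H_1(\lambda)$, and $S_N:\mathcal H_1(\lambda)\to\mathcal H_1(\lambda)$ denotes the partial sum operator $\sum_n a_ne^{-\lambda_ns}\mapsto\sum_{n=1}^N a_ne^{-\lambda_ns}$. Let $$\Lambda_N=\sup\left\{\frac{\|D\|_2}{\|D\|_1}:\ D\neq0\text{ a }\lambda\text{-Dirichlet polynomial of length }N\right\}.$$ Then there is an absolute constant $C>0$ such that, for every frequency $\lambda$ and every integer $N\ge2$, $\Lambda_N<+\infty$ and $$\|S_N\|_{\mathcal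 H_1(\lambda)\to\mathcal H_1(\lambda)}\le C\log\Lambda_N \qquad\text{and}\qquad \|S_N\|_{\mathcal H_1(\lambda)\to\mathcal H_1(\lambda)}\le C\log N .$$ -/

import Mathlib

/-- A frequency: a strictly increasing sequence of nonnegative real numbers tending to `+∞`.
Indices start at `0`, so `l.val n` is the `(n+1)`-st frequency. -/
structure Frequency where
  val : ℕ → ℝ
  nonneg : ∀ n, 0 ≤ val n
  strictMono : StrictMono val
  tendsto : Filter.Tendsto val Filter.atTop Filter.atTop

/-- The `l`-Dirichlet polynomials, given by their (finitely supported) coefficients. -/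
def DirichletPolynomial (_l : Frequency) : Type := ℕ →₀ ℂ

namespace DirichletPolynomial

open Filter Topology MeasureTheory

noncomputable instance (l : Frequency) : AddCommGroup (DirichletPolynomial l) :=
  inferInstanceAs (AddCommGroup (ℕ →₀ ℂ))

noncomputable instance (l : Frequency) : Module ℂ (DirichletPolynomial l) :=
  inferInstanceAs (Module ℂ (ℕ →₀ ℂ))

variable {l : Frequency}

/-- The `n`-th coefficient, as a linear form. -/
noncomputable def coeffLin (l : Frequency) (n : ℕ) : DirichletPolynomial l →ₗ[ℂ] ℂ :=
  (Finsupp.lapply n : (ℕ →₀ ℂ) →ₗ[ℂ] ℂ)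

/-- The `n`-th coefficient of a Dirichlet polynomial. -/
noncomputable def coeff (D : DirichletPolynomial l) (n : ℕ) : ℂ := coeffLin l n D

/-- The monomial `exp (-λ_n s)`. -/
noncomputable def monomial (l : Frequency) (n : ℕ) : DirichletPolynomial l :=
  (Finsupp.single n (1 : ℂ) : ℕ →₀ ℂ)

/-- The value `D(s) = ∑ a_n exp (-λ_n s)`, as a linear form in `D`. -/
noncomputable def evalLin (l : Frequency) (s : ℂ) : DirichletPolynomial l →ₗ[ℂ] ℂ :=
  (Finsupp.linearCombination ℂ (fun n : ℕ => Complex.exp (-(l.val n : ℂ) * s)) :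
    (ℕ →₀ ℂ) →ₗ[ℂ] ℂ)

/-- The value `D(s) = ∑ a_n exp (-λ_n s)`. -/
noncomputable def eval (D : DirichletPolynomial l) (s : ℂ) : ℂ := evalLin l s D

/-- The Hardy norm `‖D‖_p = (lim_{T → ∞} (1 / 2T) ∫_{-T}^{T} |D(it)|^p dt)^{1/p}`. -/
noncomputable def hardyNorm (p : ℝ) (D : DirichletPolynomial l) : ℝ :=
  (limUnder atTop (fun T : ℝ =>
    (1 / (2 * T)) * ∫ t in (-T)..T, ‖D.eval (t * Complex.I)‖ ^ p)) ^ (1 / p)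

theorem eval_eq_sum (D : DirichletPolynomial l) (s : ℂ) :
    D.eval s = ∑ n ∈ Finsupp.support D, D.coeff n * Complex.exp (-(l.val n : ℂ) * s) := rfl

theorem eval_add (D E : DirichletPolynomial l) (s : ℂ) :
    (D + E).eval s = D.eval s + E.eval s := map_add (evalLin l s) D E

theorem eval_smul (c : ℂ) (D : DirichletPolynomial l) (s : ℂ) :
    (c • D).eval s = c * D.eval s := map_smul (evalLin l s) c D

/-- The pure oscillations `t ↦ exp (iωt)`. -/
noncomputable def osc : Multiplicative ℝ →* (ℝ → ℂ) where
  toFun w := fun t => Complex.exp ((w.toAdd * t : ℝ) * Complex.I)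
  map_one' := by ext t; simp
  map_mul' := by
    intro a b
    ext t
    simp only [toAdd_mul, Pi.mul_apply, ← Complex.exp_add]
    congr 1
    push_cast
    ring

/-- The algebra of trigonometric polynomials on the line. -/
noncomputable def trigAlg : Subalgebra ℂ (ℝ → ℂ) :=
  Algebra.adjoin ℂ (Set.range osc)

theorem osc_mem (w : Multiplicative ℝ) : osc w ∈ trigAlg :=
  Algebra.subset_adjoin ⟨w, rfl⟩

theorem trigAlg_induction {P : (ℝ → ℂ) → Prop} (h_osc : ∀ w, P (osc w))
    (h_zero : P 0) (h_add : ∀ f g, P f → P g → P (f + g)) (h_smul : ∀ (c : ℂ) f, P f → P (c • f))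
    {f : ℝ → ℂ} (hf : f ∈ trigAlg) : P f := by
  have h1 : f ∈ Subalgebra.toSubmodule trigAlg := hf
  rw [trigAlg, Algebra.adjoin_eq_span] at h1
  have h2 : ((Submonoid.closure (Set.range osc) : Submonoid (ℝ → ℂ)) : Set (ℝ → ℂ))
      = Set.range osc := by
    rw [← MonoidHom.coe_mrange, Submonoid.closure_eq]
  rw [h2] at h1
  clear hf
  induction h1 using Submodule.span_induction with
  | mem x hx => obtain ⟨w, rfl⟩ := hx; exact h_osc w
  | zero => exact h_zero
  | add x y _ _ hx hy => exact h_add x y (hx) (hy)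
  | smul c x _ hx => exact h_smul c x hx

theorem trigAlg_continuous {f : ℝ → ℂ} (hf : f ∈ trigAlg) : Continuous f := by
  refine trigAlg_induction (P := Continuous) ?_ continuous_const
    (fun f g hf hg => hf.add hg) (fun c f hf => hf.const_smul c) hf
  intro w
  simp only [osc, MonoidHom.coe_mk, OneHom.coe_mk]
  fun_prop

/-- The mean of a function over `[-T, T]`. -/
noncomputable def avg {E : Type*} [NormedAddCommGroup E] [NormedSpace ℝ E] (f : ℝ → E) (T : ℝ) :
    E := (1 / (2 * T)) • ∫ t in (-T)..T, f t

theorem avg_osc (w : Multiplicative ℝ) :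
    Tendsto (avg (osc w)) atTop (𝓝 (if w = 1 then 1 else 0)) := by
  by_cases hw : w = 1
  · subst hw
    simp only [if_true]
    refine tendsto_const_nhds.congr' ?_
    filter_upwards [eventually_gt_atTop 0] with T hT
    simp only [avg, map_one, Pi.one_apply, intervalIntegral.integral_const]
    rw [smul_smul]
    have : 1 / (2 * T) * (T - -T) = 1 := by field_simp; ring
    rw [this, one_smul]
  · simp only [if_neg hw]
    have hw' : w.toAdd ≠ 0 := fun h => hw (by rw [← ofAdd_toAdd w, h]; rfl)
    have hc : ((w.toAdd : ℂ) * Complex.I) ≠ 0 := by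
      simp [hw']
    rw [tendsto_zero_iff_norm_tendsto_zero]
    have hb : Tendsto (fun T : ℝ => (1 / |w.toAdd|) * T⁻¹) atTop (𝓝 0) := by
      simpa using tendsto_inv_atTop_zero.const_mul (1 / |w.toAdd|)
    refine squeeze_zero' (Eventually.of_forall fun _ => norm_nonneg _) ?_ hb
    filter_upwards [eventually_gt_atTop 0] with T hT
    have h1 : ∫ t in (-T)..T, osc w t
        = (Complex.exp ((w.toAdd : ℂ) * Complex.I * T)
          - Complex.exp ((w.toAdd : ℂ) * Complex.I * (-T : ℝ))) / ((w.toAdd : ℂ) * Complex.I) := by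
      rw [← integral_exp_mul_complex hc]
      congr 1
      ext t
      simp only [osc, MonoidHom.coe_mk, OneHom.coe_mk]
      congr 1
      push_cast
      ring
    have h2 : ∀ x : ℝ, ‖Complex.exp ((w.toAdd : ℂ) * Complex.I * x)‖ = 1 := by
      intro x
      have : (w.toAdd : ℂ) * Complex.I * x = ((w.toAdd * x : ℝ) : ℂ) * Complex.I := by
        push_cast; ring
      rw [this, Complex.norm_exp_ofReal_mul_I]
    have h3 : ‖∫ t in (-T)..T, osc w t‖ ≤ 2 / |w.toAdd| := by
      rw [h1, norm_div, norm_mul, Complex.norm_I, mul_one, Complex.norm_real, Real.norm_eq_abs]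
      gcongr
      calc _ ≤ _ := norm_sub_le _ _
        _ = 2 := by rw [h2, h2]; norm_num
    rw [avg, norm_smul, Real.norm_eq_abs, abs_of_pos (by positivity)]
    calc 1 / (2 * T) * ‖∫ t in (-T)..T, osc w t‖ ≤ 1 / (2 * T) * (2 / |w.toAdd|) := by gcongr
      _ = 1 / |w.toAdd| * T⁻¹ := by
        have : |w.toAdd| ≠ 0 := abs_ne_zero.mpr hw'
        field_simp

theorem avg_add {E : Type*} [NormedAddCommGroup E] [NormedSpace ℝ E] {f g : ℝ → E}
    (hf : Continuous f) (hg : Continuous g) (T : ℝ) : avg (f + g) T = avg f T + avg g T := by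
  simp only [avg, Pi.add_apply, ← smul_add]
  rw [intervalIntegral.integral_add (hf.intervalIntegrable _ _) (hg.intervalIntegrable _ _)]

theorem avg_smul (c : ℂ) (f : ℝ → ℂ) (T : ℝ) : avg (c • f) T = c • avg f T := by
  simp only [avg, Pi.smul_apply, intervalIntegral.integral_smul]
  rw [smul_comm]

theorem norm_avg_le {E : Type*} [NormedAddCommGroup E] [NormedSpace ℝ E] {f : ℝ → E} {T : ℝ}
    (hT : 0 < T) : ‖avg f T‖ ≤ avg (fun t => ‖f t‖) T := by
  simp only [avg]
  rw [norm_smul, Real.norm_eq_abs, abs_of_pos (by positivity), smul_eq_mul]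
  gcongr
  exact intervalIntegral.norm_integral_le_integral_norm (by linarith)

theorem avg_mono {f g : ℝ → ℝ} (hf : Continuous f) (hg : Continuous g) (h : ∀ t, f t ≤ g t)
    {T : ℝ} (hT : 0 < T) : avg f T ≤ avg g T := by
  simp only [avg, smul_eq_mul]
  gcongr
  exact intervalIntegral.integral_mono (by linarith) (hf.intervalIntegrable _ _)
    (hg.intervalIntegrable _ _) h

theorem avg_const {T : ℝ} (hT : 0 < T) (c : ℝ) : avg (fun _ => c) T = c := by
  simp only [avg, intervalIntegral.integral_const, smul_eq_mul]
  field_simp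
  ring

theorem avg_ofReal (f : ℝ → ℝ) (T : ℝ) : avg (fun t => (f t : ℂ)) T = ((avg f T : ℝ) : ℂ) := by
  simp only [avg, intervalIntegral.integral_ofReal, smul_eq_mul, Complex.real_smul]
  push_cast
  ring

theorem trigAlg_mean {f : ℝ → ℂ} (hf : f ∈ trigAlg) :
    ∃ m, Tendsto (avg f) atTop (𝓝 m) := by
  have h := trigAlg_induction
    (P := fun f => Continuous f ∧ ∃ m, Tendsto (avg f) atTop (𝓝 m)) ?_ ?_ ?_ ?_ hf
  · exact h.2
  · exact fun w => ⟨trigAlg_continuous (osc_mem w), _, avg_osc w⟩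
  · refine ⟨continuous_const, 0, ?_⟩
    have : avg (0 : ℝ → ℂ) = fun _ => 0 := by ext T; simp [avg]
    rw [this]
    exact tendsto_const_nhds
  · rintro f g ⟨hf, m, hm⟩ ⟨hg, k, hk⟩
    refine ⟨hf.add hg, m + k, ?_⟩
    have : avg (f + g) = fun T => avg f T + avg g T := funext fun T => avg_add hf hg T
    rw [this]
    exact hm.add hk
  · rintro c f ⟨hf, m, hm⟩
    refine ⟨hf.const_smul c, c • m, ?_⟩
    have : avg (c • f) = fun T => c • avg f T := funext fun T => avg_smul c f T
    rw [this]
    exact hm.const_smul c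

/-- The boundary function `t ↦ D(it)`. -/
noncomputable def bdry (D : DirichletPolynomial l) (t : ℝ) : ℂ := D.eval (t * Complex.I)

theorem bdry_eq (D : DirichletPolynomial l) :
    D.bdry = ∑ n ∈ Finsupp.support D, D.coeff n • osc (Multiplicative.ofAdd (-l.val n)) := by
  ext t
  rw [bdry, eval_eq_sum, Finset.sum_apply]
  refine Finset.sum_congr rfl fun n _ => ?_
  simp only [Pi.smul_apply, smul_eq_mul, osc, MonoidHom.coe_mk, OneHom.coe_mk, toAdd_ofAdd]
  congr 2
  push_cast
  ring

theorem bdry_mem (D : DirichletPolynomial l) : D.bdry ∈ trigAlg := by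
  rw [bdry_eq]
  exact Subalgebra.sum_mem _ fun n _ => Subalgebra.smul_mem _ (osc_mem _) _

theorem bdry_continuous (D : DirichletPolynomial l) : Continuous D.bdry :=
  trigAlg_continuous D.bdry_mem

theorem star_osc (w : Multiplicative ℝ) : star (osc w) = osc w⁻¹ := by
  ext t
  simp only [osc, MonoidHom.coe_mk, OneHom.coe_mk, Pi.star_apply, toAdd_inv]
  rw [RCLike.star_def, ← Complex.exp_conj]
  congr 1
  simp

theorem star_mem {f : ℝ → ℂ} (hf : f ∈ trigAlg) : star f ∈ trigAlg := by
  refine trigAlg_induction (P := fun f => star f ∈ trigAlg) ?_ ?_ ?_ ?_ hf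
  · intro w
    rw [star_osc]
    exact osc_mem _
  · rw [star_zero]
    exact Subalgebra.zero_mem _
  · intro f g hf hg
    rw [star_add]
    exact Subalgebra.add_mem _ hf hg
  · intro c f hf
    rw [star_smul]
    exact Subalgebra.smul_mem _ hf _

theorem norm_osc (w : Multiplicative ℝ) (t : ℝ) : ‖osc w t‖ = 1 := by
  simp only [osc, MonoidHom.coe_mk, OneHom.coe_mk]
  exact Complex.norm_exp_ofReal_mul_I _

theorem trigAlg_bounded {f : ℝ → ℂ} (hf : f ∈ trigAlg) : ∃ M, ∀ t, ‖f t‖ ≤ M := by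
  refine trigAlg_induction (P := fun f => ∃ M, ∀ t, ‖f t‖ ≤ M) ?_ ?_ ?_ ?_ hf
  · exact fun w => ⟨1, fun t => (norm_osc w t).le⟩
  · exact ⟨0, fun t => by simp⟩
  · rintro f g ⟨M, hM⟩ ⟨K, hK⟩
    exact ⟨M + K, fun t => (norm_add_le _ _).trans (add_le_add (hM t) (hK t))⟩
  · rintro c f ⟨M, hM⟩
    refine ⟨‖c‖ * M, fun t => ?_⟩
    rw [Pi.smul_apply, norm_smul]
    exact mul_le_mul_of_nonneg_left (hM t) (norm_nonneg c)

/-- The means of `|D(it)|^p` converge. -/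
theorem exists_mean (D : DirichletPolynomial l) {p : ℝ} (hp : 0 < p) :
    ∃ m, Tendsto (avg (fun t => ‖D.bdry t‖ ^ p)) atTop (𝓝 m) := by
  obtain ⟨M, hM⟩ := trigAlg_bounded D.bdry_mem
  have hM0 : 0 ≤ M := (norm_nonneg _).trans (hM 0)
  have hcont : Continuous (fun t => ‖D.bdry t‖ ^ p) :=
    D.bdry_continuous.norm.rpow_const fun _ => Or.inr hp.le
  refine cauchy_map_iff_exists_tendsto.mp ?_
  rw [Metric.cauchy_iff]
  refine ⟨inferInstance, fun ε hε => ?_⟩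
  obtain ⟨P, hP⟩ := exists_polynomial_near_of_continuousOn 0 (M ^ 2) (fun x => x ^ (p / 2))
    ((Real.continuous_rpow_const (by positivity)).continuousOn) (ε / 4) (by positivity)
  have hsq : ∀ t, ((‖D.bdry t‖ ^ 2 : ℝ) : ℂ) = (D.bdry * star D.bdry) t := by
    intro t
    rw [Pi.mul_apply, Pi.star_apply, RCLike.star_def, Complex.mul_conj, Complex.normSq_eq_norm_sq]
  have hmem : (fun t => ((P.eval (‖D.bdry t‖ ^ 2) : ℝ) : ℂ)) ∈ trigAlg := by
    have : (fun t => ((P.eval (‖D.bdry t‖ ^ 2) : ℝ) : ℂ))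
        = ∑ i ∈ Finset.range (P.natDegree + 1),
          ((P.coeff i : ℝ) : ℂ) • (D.bdry * star D.bdry) ^ i := by
      ext t
      rw [Polynomial.eval_eq_sum_range, Finset.sum_apply]
      push_cast
      refine Finset.sum_congr rfl fun i _ => ?_
      rw [Pi.smul_apply, Pi.pow_apply, ← hsq, smul_eq_mul]
      push_cast
      rfl
    rw [this]
    exact Subalgebra.sum_mem _ fun i _ => Subalgebra.smul_mem _
      (Subalgebra.pow_mem _ (Subalgebra.mul_mem _ D.bdry_mem (star_mem D.bdry_mem)) _) _
  have hPc : Continuous (fun t => P.eval (‖D.bdry t‖ ^ 2)) :=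
    P.continuous.comp (D.bdry_continuous.norm.pow 2)
  obtain ⟨m, hm⟩ := trigAlg_mean hmem
  have hclose : ∀ t, ‖P.eval (‖D.bdry t‖ ^ 2) - ‖D.bdry t‖ ^ p‖ ≤ ε / 4 := by
    intro t
    have h := hP (‖D.bdry t‖ ^ 2) ⟨by positivity, by gcongr; exact hM t⟩
    have e : (‖D.bdry t‖ ^ 2) ^ (p / 2) = ‖D.bdry t‖ ^ p := by
      rw [← Real.rpow_natCast, ← Real.rpow_mul (norm_nonneg _)]
      congr 1
      push_cast
      ring
    rw [e] at h
    exact h.le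
  have hm' : Tendsto (avg (fun t => P.eval (‖D.bdry t‖ ^ 2))) atTop (𝓝 m.re) := by
    have h := (Complex.continuous_re.tendsto m).comp hm
    refine h.congr fun T => ?_
    rw [Function.comp, avg_ofReal, Complex.ofReal_re]
  have hdist : ∀ T > 0, |avg (fun t => P.eval (‖D.bdry t‖ ^ 2)) T
      - avg (fun t => ‖D.bdry t‖ ^ p) T| ≤ ε / 4 := by
    intro T hT
    have e : avg (fun t => P.eval (‖D.bdry t‖ ^ 2)) T
        - avg (fun t => ‖D.bdry t‖ ^ p) T
        = avg (fun t => P.eval (‖D.bdry t‖ ^ 2) - ‖D.bdry t‖ ^ p) T := by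
      simp only [avg, ← smul_sub]
      rw [intervalIntegral.integral_sub (hPc.intervalIntegrable _ _)
        (hcont.intervalIntegrable _ _)]
    rw [e, ← Real.norm_eq_abs]
    refine (norm_avg_le hT).trans ?_
    refine (avg_mono (hPc.sub hcont).norm continuous_const hclose hT).trans ?_
    rw [avg_const hT]
  have hev : ∀ᶠ T in atTop, |avg (fun t => ‖D.bdry t‖ ^ p) T - m.re| < ε / 2 := by
    filter_upwards [eventually_gt_atTop 0, Metric.tendsto_nhds.mp hm' (ε / 4) (by positivity)]
      with T hT h2
    have h1 := hdist T hT
    rw [Real.dist_eq] at h2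
    rw [abs_le] at h1
    rw [abs_lt] at h2 ⊢
    constructor <;> linarith [h1.1, h1.2, h2.1, h2.2]
  refine ⟨_, Filter.image_mem_map hev, ?_⟩
  rintro _ ⟨S, hS, rfl⟩ _ ⟨T, hT, rfl⟩
  simp only [Set.mem_ofPred_eq] at hS hT
  rw [Real.dist_eq]
  rw [abs_lt] at *
  constructor <;> linarith [hS.1, hS.2, hT.1, hT.2]

theorem hardyNorm_def (p : ℝ) (D : DirichletPolynomial l) :
    D.hardyNorm p = (limUnder atTop (avg (fun t => ‖D.bdry t‖ ^ p))) ^ (1 / p) := rfl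

/-- The limit that defines the Hardy norm exists. -/
theorem tendsto_hardyNorm (D : DirichletPolynomial l) {p : ℝ} (hp : 0 < p) :
    Tendsto (fun T : ℝ => (1 / (2 * T)) * ∫ t in (-T)..T, ‖D.eval (t * Complex.I)‖ ^ p)
      atTop (𝓝 (D.hardyNorm p ^ p)) := by
  have h := tendsto_nhds_limUnder (D.exists_mean hp)
  have h0 : 0 ≤ limUnder atTop (avg (fun t => ‖D.bdry t‖ ^ p)) := by
    refine ge_of_tendsto h ?_
    filter_upwards [eventually_gt_atTop 0] with T hT
    have h1 := norm_avg_le (f := fun t => ‖D.bdry t‖ ^ p) hT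
    have h2 : ∀ t, ‖‖D.bdry t‖ ^ p‖ = ‖D.bdry t‖ ^ p :=
      fun t => Real.norm_of_nonneg (by positivity)
    simp only [h2] at h1
    exact (norm_nonneg _).trans h1
  rw [hardyNorm_def, ← Real.rpow_mul h0, one_div_mul_cancel hp.ne', Real.rpow_one]
  exact h

theorem tendsto_hardyNorm_one (D : DirichletPolynomial l) :
    Tendsto (avg (fun t => ‖D.bdry t‖)) atTop (𝓝 (D.hardyNorm 1)) := by
  have h := D.tendsto_hardyNorm one_pos
  simp only [Real.rpow_one] at h
  exact h

theorem norm_coeff_le (D : DirichletPolynomial l) (n : ℕ) : ‖D.coeff n‖ ≤ D.hardyNorm 1 := by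
  have h1 : Tendsto (avg (D.bdry * osc (Multiplicative.ofAdd (l.val n)))) atTop
      (𝓝 (D.coeff n)) := by
    have e : avg (D.bdry * osc (Multiplicative.ofAdd (l.val n)))
        = fun T => ∑ k ∈ Finsupp.support D,
          D.coeff k • avg (osc (Multiplicative.ofAdd (l.val n - l.val k))) T := by
      ext T
      rw [bdry_eq, Finset.sum_mul]
      simp only [smul_mul_assoc, ← map_mul, ← ofAdd_add]
      simp only [← avg_smul]
      simp only [avg, Finset.sum_apply]
      rw [intervalIntegral.integral_finsetSum, Finset.smul_sum]
      · simp only [neg_add_eq_sub]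
      · intro k _
        exact (trigAlg_continuous
          (Subalgebra.smul_mem _ (osc_mem _) _)).intervalIntegrable _ _
    rw [e]
    have h2 := tendsto_finsetSum (Finsupp.support D) fun k _ =>
      (avg_osc (Multiplicative.ofAdd (l.val n - l.val k))).const_smul (D.coeff k)
    convert h2 using 2
    have h3 : ∀ k, (Multiplicative.ofAdd (l.val n - l.val k) = 1) ↔ k = n := by
      intro k
      rw [ofAdd_eq_one, sub_eq_zero, l.strictMono.injective.eq_iff, eq_comm]
    simp only [h3, smul_eq_mul, mul_ite, mul_one, mul_zero, Finset.sum_ite_eq']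
    split_ifs with hn
    · rfl
    · exact Finsupp.notMem_support_iff.mp hn
  refine le_of_tendsto_of_tendsto h1.norm D.tendsto_hardyNorm_one ?_
  filter_upwards [eventually_gt_atTop 0] with T hT
  refine (norm_avg_le hT).trans_eq ?_
  congr 1
  ext t
  rw [Pi.mul_apply, norm_mul, norm_osc, mul_one]

/-- The norm on Dirichlet polynomials is the `H_1`-norm. -/
noncomputable instance (l : Frequency) : Norm (DirichletPolynomial l) := ⟨hardyNorm 1⟩

theorem norm_def (D : DirichletPolynomial l) : ‖D‖ = D.hardyNorm 1 := rfl

theorem normCore (l : Frequency) : NormedSpace.Core ℂ (DirichletPolynomial l) where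
  norm_nonneg D := (norm_nonneg _).trans (D.norm_coeff_le 0)
  norm_smul c D := by
    refine tendsto_nhds_unique (tendsto_hardyNorm_one _) ?_
    have e : avg (fun t => ‖(c • D).bdry t‖) = fun T => ‖c‖ * avg (fun t => ‖D.bdry t‖) T := by
      ext T
      simp only [avg, bdry, eval_smul, norm_mul, intervalIntegral.integral_const_mul, smul_eq_mul]
      ring
    rw [e]
    exact D.tendsto_hardyNorm_one.const_mul _
  norm_triangle D E := by
    refine le_of_tendsto_of_tendsto (tendsto_hardyNorm_one _)
      (D.tendsto_hardyNorm_one.add E.tendsto_hardyNorm_one) ?_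
    filter_upwards [eventually_gt_atTop 0] with T hT
    rw [← avg_add D.bdry_continuous.norm E.bdry_continuous.norm]
    refine avg_mono (bdry_continuous _).norm (D.bdry_continuous.norm.add E.bdry_continuous.norm)
      (fun t => ?_) hT
    rw [bdry, eval_add]
    exact norm_add_le _ _
  norm_eq_zero_iff D := by
    constructor
    · intro h
      refine Finsupp.ext fun n => ?_
      have := D.norm_coeff_le n
      rw [← norm_def, h] at this
      exact norm_le_zero_iff.mp this
    · rintro rfl
      refine tendsto_nhds_unique (tendsto_hardyNorm_one _) ?_
      have e : avg (fun t => ‖(0 : DirichletPolynomial l).bdry t‖) = fun _ => 0 := by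
        ext T
        have : ∀ s, (0 : DirichletPolynomial l).eval s = 0 := fun s => map_zero (evalLin l s)
        simp [avg, bdry, this]
      rw [e]
      exact tendsto_const_nhds

noncomputable instance (l : Frequency) : NormedAddCommGroup (DirichletPolynomial l) :=
  NormedAddCommGroup.ofCore (normCore l)

noncomputable instance (l : Frequency) : NormedSpace ℂ (DirichletPolynomial l) :=
  NormedSpace.ofCore (normCore l)

/-- The `n`-th coefficient, as a continuous linear form for the `H_1`-norm. -/
noncomputable def coeffCLM (l : Frequency) (n : ℕ) : DirichletPolynomial l →L[ℂ] ℂ :=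
  (coeffLin l n).mkContinuous 1 fun D => by
    rw [one_mul]
    exact D.norm_coeff_le n

end DirichletPolynomial

/-- The Hardy space `H_1(λ)`: the completion of the space of `λ`-Dirichlet polynomials for the
norm `‖·‖_1`. -/
abbrev HardyOne (l : Frequency) : Type := UniformSpace.Completion (DirichletPolynomial l)

namespace HardyOne

/-- The `n`-th coefficient of an element of `H_1(λ)`: the continuous extension of the coefficient
form on Dirichlet polynomials. -/
noncomputable def coeff (l : Frequency) (n : ℕ) : HardyOne l →L[ℂ] ℂ :=
  (DirichletPolynomial.coeffCLM l n).extend UniformSpace.Completion.toComplL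

/-- The partial sum operator `S_N` on `H_1(λ)`, which sends `∑ a_n exp (-λ_n s)` to the sum of
its first `N` terms. -/
noncomputable def partialSum (l : Frequency) (N : ℕ) : HardyOne l →L[ℂ] HardyOne l :=
  ∑ n ∈ Finset.range N, (coeff l n).smulRight (DirichletPolynomial.monomial l n : HardyOne l)

theorem coeff_coe (l : Frequency) (n : ℕ) (D : DirichletPolynomial l) :
    coeff l n (D : HardyOne l) = D.coeff n :=
  ContinuousLinearMap.extend_eq _ UniformSpace.Completion.denseRange_coe
    (UniformSpace.Completion.isUniformInducing_coe _) D

end HardyOne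

/-- The quotients `‖D‖_2 / ‖D‖_1`, where `D` runs over the nonzero `λ`-Dirichlet polynomials
of length `N`. -/
def hardyRatios (l : Frequency) (N : ℕ) : Set ℝ :=
  {r | ∃ D : DirichletPolynomial l, D ≠ 0 ∧ (∀ n, N ≤ n → D.coeff n = 0) ∧
    r = D.hardyNorm 2 / D.hardyNorm 1}

/-- `Λ_N`, the supremum of these quotients. -/
noncomputable def hardyRatioSup (l : Frequency) (N : ℕ) : ℝ := sSup (hardyRatios l N)

namespace DirichletPolynomial

open Filter Topology MeasureTheory

/-! Multiplying by the unimodular factor `exp (iλt)`, with `λ` the last frequency kept, turns a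
partial sum into the projection of a trigonometric polynomial on the line onto its nonnegative
frequencies. This projection is unbounded on `L¹`, but Kolmogorov's inequality sends `L¹` into `L^p`
for `p < 1`, with `‖S_N D‖_p^p ≤ 5 ‖D‖_1^p / (1 - p)` (`meanLE_cut_rpow`). It rests on an identity:
if `F` has nonnegative frequencies and real part bounded below by some `δ > 0`, the mean of `F^p` is
the `p`-th power of the mean of `F` (`mean_cpow`), while `Re F^p ≥ (1 - p) |F|^p`.

To return to the norm `‖·‖_1`, put `A = ‖S_N D‖_1` and `q = 1 - p`. Splitting at height `R = 2 Λ_N²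
A` (`hardyNorm_one_interpolate`) bounds `A` by `R^q ‖S_N D‖_p^p` plus `‖S_N D‖_2² / R`. Since `S_N
D` has length `N`, the second term is at most `A / 2` and is absorbed. With `q` of order `1 / log
Λ_N`, the factor `Λ_N^{2q}` stays bounded and the loss `1 / q` is of order `log Λ_N`
(`le_of_interpolation`).

The additive constants are absorbed because `Λ_N ≥ 32 / 31` uniformly in the frequency
(`le_hardyRatioSup`). The bound in `log N` follows from `Λ_N ≤ √N`. -/

/-! ### Holomorphic approximation and powers in the right half-plane -/

/-- Taylor sums converge uniformly on smaller discs. Polynomials in `z` alone, without conjugates,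
are needed, because only these preserve nonnegative frequencies. -/
theorem exists_polynomial_near_of_differentiableOn {f : ℂ → ℂ} {c : ℂ} {r R : ℝ} (hr : 0 ≤ r)
    (hrR : r < R) (hf : DifferentiableOn ℂ f (Metric.closedBall c R)) {ε : ℝ} (hε : 0 < ε) :
    ∃ Q : Polynomial ℂ, ∀ z ∈ Metric.closedBall c r, ‖Q.eval z - f z‖ < ε := by
  lift R to NNReal using hr.trans hrR.le
  have hR : 0 < R := by
    have : (0 : ℝ) < R := hr.trans_lt hrR
    exact_mod_cast this
  obtain ⟨s, hrs, hsR⟩ := exists_between hrR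
  lift s to NNReal using hr.trans hrs.le
  have h := (hf.hasFPowerSeriesOnBall hR).tendstoUniformlyOn' (r' := s) (by exact_mod_cast hsR)
  obtain ⟨n, hn⟩ := (Metric.tendstoUniformlyOn_iff.mp h ε hε).exists
  refine ⟨∑ k ∈ Finset.range n, Polynomial.C ((cauchyPowerSeries f c R).coeff k) *
    (Polynomial.X - Polynomial.C c) ^ k, fun z hz => ?_⟩
  have hz' := hn z (Metric.closedBall_subset_ball hrs hz)
  rw [dist_comm, dist_eq_norm] at hz'
  refine lt_of_eq_of_lt (congrArg (fun w => ‖w - f z‖) ?_) hz'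
  rw [Polynomial.eval_finsetSum]
  refine Finset.sum_congr rfl fun k _ => ?_
  rw [FormalMultilinearSeries.apply_eq_prod_smul_coeff]
  simp [mul_comm]

/-- Powers are close to polynomials on discs inside the right half-plane. -/
theorem exists_polynomial_near_cpow (p : ℝ) {r R : ℝ} (hr : 0 ≤ r) (hrR : r < R) {ε : ℝ}
    (hε : 0 < ε) :
    ∃ Q : Polynomial ℂ, ∀ z ∈ Metric.closedBall (R : ℂ) r, ‖Q.eval z - z ^ (p : ℂ)‖ < ε := by
  obtain ⟨s, hrs, hsR⟩ := exists_between hrR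
  refine exists_polynomial_near_of_differentiableOn hr hrs (fun z hz => ?_) hε
  have hz' : ‖z - R‖ ≤ s := by simpa [dist_eq_norm] using hz
  have h1 := (abs_le.mp ((Complex.abs_re_le_norm _).trans hz')).1
  rw [Complex.sub_re, Complex.ofReal_re] at h1
  exact ((hasStrictDerivAt_id z).cpow_const (Or.inl (by simp; linarith))).hasDerivAt
    |>.differentiableAt.differentiableWithinAt

/-- The argument of `z ^ p` is `p * arg z`, and `|arg z| ≤ π / 2` in the right half-plane. -/
theorem cos_mul_norm_rpow_le {p : ℝ} (hp : 0 < p) (hp1 : p < 1) {z : ℂ} (hz : 0 < z.re) :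
    Real.cos (p * (Real.pi / 2)) * ‖z‖ ^ p ≤ (z ^ (p : ℂ)).re := by
  have hz0 : z ≠ 0 := by rintro rfl; simp at hz
  have harg := Complex.abs_arg_le_pi_div_two_iff.mpr hz.le
  have hpos : 0 < ‖z‖ := norm_pos_iff.mpr hz0
  have e : (z ^ (p : ℂ)).re = ‖z‖ ^ p * Real.cos (p * z.arg) := by
    rw [Complex.cpow_def_of_ne_zero hz0, Complex.exp_re, Complex.re_mul_ofReal,
      Complex.im_mul_ofReal, Complex.log_re, Complex.log_im, Real.rpow_def_of_pos hpos, mul_comm p]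
  rw [e, mul_comm]
  gcongr
  rw [← Real.cos_abs (p * z.arg), abs_mul, abs_of_pos hp]
  have hpi := Real.pi_pos
  refine Real.cos_le_cos_of_nonneg_of_le_pi (by positivity) ?_ (by gcongr)
  nlinarith

/-- Jordan's inequality `sin x ≥ 2x / π` at `x = (1 - p) π / 2`. -/
theorem one_sub_le_cos {p : ℝ} (hp : 0 < p) (hp1 : p < 1) :
    1 - p ≤ Real.cos (p * (Real.pi / 2)) := by
  have hpi := Real.pi_pos
  have h := Real.mul_le_sin (x := (1 - p) * (Real.pi / 2))
    (mul_nonneg (by linarith) (by positivity)) (by nlinarith)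
  rw [show (1 - p) * (Real.pi / 2) = Real.pi / 2 - p * (Real.pi / 2) by ring,
    Real.sin_pi_div_two_sub] at h
  refine le_trans (le_of_eq ?_) h
  field_simp

/-! ### Functions with nonnegative frequencies -/

/-- The span of the oscillations with positive frequency. -/
noncomputable def posFreq : Submodule ℂ (ℝ → ℂ) :=
  Submodule.span ℂ (osc '' {w | 0 < w.toAdd})

theorem posFreq_le_trigAlg : posFreq ≤ Subalgebra.toSubmodule trigAlg := by
  rw [posFreq, Submodule.span_le]
  rintro _ ⟨w, -, rfl⟩
  exact osc_mem w

theorem posFreq_mul_mem {F G : ℝ → ℂ} (hF : F ∈ posFreq) (hG : G ∈ posFreq) :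
    F * G ∈ posFreq := by
  have h : F * G ∈ posFreq * posFreq := Submodule.mul_mem_mul hF hG
  rw [posFreq, Submodule.span_mul_span] at h
  refine Submodule.span_mono ?_ h
  rintro _ ⟨_, ⟨v, hv, rfl⟩, _, ⟨w, hw, rfl⟩, rfl⟩
  exact ⟨v * w, add_pos (α := ℝ) hv hw, map_mul _ _ _⟩

theorem posFreq_mean {G : ℝ → ℂ} (hG : G ∈ posFreq) : Tendsto (avg G) atTop (𝓝 0) := by
  have h : Continuous G ∧ Tendsto (avg G) atTop (𝓝 0) := by
    induction hG using Submodule.span_induction with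
    | mem x hx =>
      obtain ⟨w, hw, rfl⟩ := hx
      have hw1 : w ≠ 1 := by rintro rfl; exact lt_irrefl (0 : ℝ) hw
      exact ⟨trigAlg_continuous (osc_mem w), by simpa [hw1] using avg_osc w⟩
    | zero =>
      refine ⟨continuous_const, ?_⟩
      have : avg (0 : ℝ → ℂ) = fun _ => 0 := by ext T; simp [avg]
      rw [this]
      exact tendsto_const_nhds
    | add x y _ _ hx hy =>
      refine ⟨hx.1.add hy.1, ?_⟩
      rw [funext fun T => avg_add hx.1 hy.1 T]
      simpa using hx.2.add hy.2
    | smul c x _ hx =>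
      refine ⟨hx.1.const_smul c, ?_⟩
      rw [funext fun T => avg_smul c x T]
      simpa using hx.2.const_smul c
  exact h.2

/-- The functions with nonnegative frequencies, paired with their constant coefficient. -/
noncomputable def analyticGraph : Subalgebra ℂ ((ℝ → ℂ) × ℂ) where
  carrier := {x | x.1 - (fun _ => x.2) ∈ posFreq}
  mul_mem' := by
    rintro ⟨F, a⟩ ⟨G, b⟩ hF hG
    simp only [Set.mem_ofPred_eq, Prod.mk_mul_mk] at *
    have e : F * G - (fun _ => a * b) = (F - fun _ => a) * (G - fun _ => b)
        + (a • (G - fun _ => b) + b • (F - fun _ => a)) := by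
      ext t; simp; ring
    rw [e]
    exact add_mem (posFreq_mul_mem hF hG)
      (add_mem (Submodule.smul_mem _ _ hG) (Submodule.smul_mem _ _ hF))
  add_mem' := by
    rintro ⟨F, a⟩ ⟨G, b⟩ hF hG
    simp only [Set.mem_ofPred_eq, Prod.mk_add_mk] at *
    have e : F + G - (fun _ => a + b) = (F - fun _ => a) + (G - fun _ => b) := by
      ext t; simp; ring
    rw [e]
    exact add_mem hF hG
  algebraMap_mem' c := by
    have e : (algebraMap ℂ ((ℝ → ℂ) × ℂ) c).1 - (fun _ => (algebraMap ℂ ((ℝ → ℂ) × ℂ) c).2)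
        = 0 := by
      ext t; simp
    change _ ∈ posFreq
    rw [e]
    exact zero_mem _

theorem mem_analyticGraph {F : ℝ → ℂ} {a : ℂ} :
    (F, a) ∈ analyticGraph ↔ F - (fun _ => a) ∈ posFreq := Iff.rfl

theorem continuous_of_mem_analyticGraph {F : ℝ → ℂ} {a : ℂ} (h : (F, a) ∈ analyticGraph) :
    Continuous F := by
  have h1 := (trigAlg_continuous (posFreq_le_trigAlg (mem_analyticGraph.mp h))).add
    (continuous_const (y := a))
  convert h1 using 1
  ext t; simp

theorem mean_of_mem_analyticGraph {F : ℝ → ℂ} {a : ℂ} (h : (F, a) ∈ analyticGraph) :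
    Tendsto (avg F) atTop (𝓝 a) := by
  have h1 := (posFreq_mean (mem_analyticGraph.mp h)).add_const a
  rw [zero_add] at h1
  refine h1.congr' ?_
  filter_upwards [eventually_gt_atTop 0] with T hT
  have hc := (continuous_of_mem_analyticGraph h)
  have hT' : (T : ℂ) ≠ 0 := by exact_mod_cast hT.ne'
  simp only [avg, Pi.sub_apply]
  rw [intervalIntegral.integral_sub (hc.intervalIntegrable _ _) intervalIntegrable_const,
    intervalIntegral.integral_const, smul_sub, smul_smul,
    show 1 / (2 * T) * (T - -T) = 1 by field_simp; ring, one_smul]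
  ring

/-- Together with `mean_of_mem_analyticGraph`, this says that taking means commutes with polynomials
on functions with nonnegative frequencies. -/
theorem polynomial_mem_analyticGraph {F : ℝ → ℂ} {a : ℂ} (h : (F, a) ∈ analyticGraph)
    (Q : Polynomial ℂ) : ((fun t => Q.eval (F t)), Q.eval a) ∈ analyticGraph := by
  have h1 : Polynomial.aeval ((F, a) : (ℝ → ℂ) × ℂ) Q ∈ analyticGraph :=
    Algebra.adjoin_le (Set.singleton_subset_iff.mpr h)
      (Polynomial.aeval_mem_adjoin_singleton ℂ _)
  have e : Polynomial.aeval ((F, a) : (ℝ → ℂ) × ℂ) Q = ((fun t => Q.eval (F t)), Q.eval a) := by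
    rw [Polynomial.aeval_prod_apply]
    refine Prod.ext ?_ ?_
    · ext t
      exact (Polynomial.aeval_algHom_apply (Pi.evalAlgHom ℂ (fun _ : ℝ => ℂ) t) F Q).symm
    · exact Polynomial.aeval_def ..
  rwa [e] at h1

/-- The mean of `F ^ p` is the `p`-th power of the mean, if `F` has nonnegative frequencies and
takes values in a right half-plane. -/
theorem mean_cpow (p : ℝ) {F : ℝ → ℂ} {a : ℂ} (h : (F, a) ∈ analyticGraph) {δ M : ℝ}
    (hδ : 0 < δ) (hre : ∀ t, δ ≤ (F t).re) (hM : ∀ t, ‖F t‖ ≤ M) :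
    Tendsto (avg (fun t => F t ^ (p : ℂ))) atTop (𝓝 (a ^ (p : ℂ))) := by
  have hF := continuous_of_mem_analyticGraph h
  -- The region `Re z ≥ δ`, `|z| ≤ M` lies in a disc centred at a large real `R` with radius `r <
  -- R`, since `|z - R|² ≤ M² - 2Rδ + R² < R²` there. This disc avoids the branch cut.
  obtain ⟨R, hR0, hR⟩ : ∃ R : ℝ, 0 < R ∧ M ^ 2 < 2 * R * δ :=
    ⟨(M ^ 2 + 1) / (2 * δ), by positivity, by field_simp; linarith⟩
  obtain ⟨r, hr0, hr, hrR⟩ : ∃ r : ℝ, 0 ≤ r ∧ (M ^ 2 - 2 * R * δ + R ^ 2 ≤ r ^ 2) ∧ r < R := by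
    refine ⟨√(M ^ 2 - 2 * R * δ + R ^ 2), Real.sqrt_nonneg _, ?_, ?_⟩
    -- The radicand may be negative for large `R`, hence an inequality instead of an equality.
    · rw [Real.sq_sqrt']
      exact le_max_left _ _
    · rw [Real.sqrt_lt' hR0]
      linarith
  have hball : ∀ t, F t ∈ Metric.closedBall (R : ℂ) r := by
    intro t
    rw [mem_closedBall_iff_norm]
    refine le_of_sq_le_sq ?_ hr0
    have h1 : ‖F t - R‖ ^ 2 = ‖F t‖ ^ 2 - 2 * R * (F t).re + R ^ 2 := by
      rw [← Complex.normSq_eq_norm_sq, ← Complex.normSq_eq_norm_sq, Complex.normSq_apply,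
        Complex.normSq_apply]
      simp
      ring
    have h2 : ‖F t‖ ^ 2 ≤ M ^ 2 := by gcongr; exact hM t
    have h3 : R * δ ≤ R * (F t).re := by gcongr; exact hre t
    linarith
  -- The closed disc contains the limit of the averages of `F`.
  have ha : a ∈ Metric.closedBall (R : ℂ) r := by
    rw [mem_closedBall_iff_norm]
    have h1 : (F - (fun _ => (R : ℂ)), a - R) ∈ analyticGraph :=
      sub_mem h (algebraMap_mem analyticGraph (R : ℂ))
    refine le_of_tendsto (mean_of_mem_analyticGraph h1).norm ?_
    filter_upwards [eventually_gt_atTop 0] with T hT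
    refine (norm_avg_le hT).trans ?_
    refine (avg_mono (continuous_of_mem_analyticGraph h1).norm continuous_const
      (fun t => ?_) hT).trans_eq (avg_const hT r)
    exact mem_closedBall_iff_norm.mp (hball t)
  have hc : Continuous (fun t => F t ^ (p : ℂ)) :=
    hF.cpow continuous_const fun t => Or.inl (hδ.trans_le (hre t))
  rw [Metric.tendsto_nhds]
  intro ε hε
  obtain ⟨Q, hQ⟩ := exists_polynomial_near_cpow p hr0 hrR (show 0 < ε / 3 by positivity)
  have hQm := polynomial_mem_analyticGraph h Q
  filter_upwards [eventually_gt_atTop 0,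
    Metric.tendsto_nhds.mp (mean_of_mem_analyticGraph hQm) (ε / 3) (by positivity)] with T hT h2
  have h3 : ‖avg (fun t => Q.eval (F t)) T - avg (fun t => F t ^ (p : ℂ)) T‖ ≤ ε / 3 := by
    have e : avg (fun t => Q.eval (F t)) T - avg (fun t => F t ^ (p : ℂ)) T
        = avg (fun t => Q.eval (F t) - F t ^ (p : ℂ)) T := by
      simp only [avg, ← smul_sub]
      rw [intervalIntegral.integral_sub
        ((continuous_of_mem_analyticGraph hQm).intervalIntegrable _ _)
        (hc.intervalIntegrable _ _)]
    rw [e]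
    refine (norm_avg_le hT).trans ((avg_mono ?_ continuous_const
      (fun t => (hQ _ (hball t)).le) hT).trans_eq (avg_const hT _))
    exact ((continuous_of_mem_analyticGraph hQm).sub hc).norm
  have h4 := hQ a ha
  rw [← dist_eq_norm] at h3 h4
  rw [dist_comm] at h3
  have h5 := dist_triangle4 (avg (fun t => F t ^ (p : ℂ)) T) (avg (fun t => Q.eval (F t)) T)
    (Q.eval a) (a ^ (p : ℂ))
  linarith

/-! ### Upper means -/

/-- The upper mean of `f` over the line is at most `c`. -/
def MeanLE (f : ℝ → ℝ) (c : ℝ) : Prop := ∀ ε > 0, ∀ᶠ T in atTop, avg f T ≤ c + ε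

theorem MeanLE.of_tendsto_avg {f : ℝ → ℝ} {c : ℝ} (h : Tendsto (avg f) atTop (𝓝 c)) :
    MeanLE f c := fun ε hε =>
  (h.eventually_lt_const (show c < c + ε by linarith)).mono fun _ hT => hT.le

theorem MeanLE.le_of_tendsto_avg {f : ℝ → ℝ} {m c : ℝ} (h : MeanLE f c)
    (hm : Tendsto (avg f) atTop (𝓝 m)) : m ≤ c :=
  le_of_forall_pos_le_add fun ε hε => le_of_tendsto hm (h ε hε)

/-- Serves to remove a perturbation `η` from a bound by letting it tend to `0`. -/
theorem MeanLE.of_tendsto {f : ℝ → ℝ} {φ : ℝ → ℝ} {c : ℝ} (h : ∀ η > 0, MeanLE f (φ η))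
    (hφ : Tendsto φ (𝓝[>] 0) (𝓝 c)) : MeanLE f c := by
  intro ε hε
  obtain ⟨η, hη, hlt⟩ := ((eventually_mem_nhdsWithin).and
    (hφ.eventually_lt_const (show c < c + ε / 2 by linarith))).exists
  filter_upwards [h η hη (ε / 2) (by positivity)] with T hT
  linarith

theorem MeanLE.mono {f g : ℝ → ℝ} {c : ℝ} (hg : MeanLE g c) (hfc : Continuous f)
    (hgc : Continuous g) (h : ∀ t, f t ≤ g t) : MeanLE f c := by
  intro ε hε
  filter_upwards [hg ε hε, eventually_gt_atTop 0] with T hT hT0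
  exact (avg_mono hfc hgc h hT0).trans hT

theorem MeanLE.add {f g : ℝ → ℝ} {c d : ℝ} (hf : MeanLE f c) (hg : MeanLE g d)
    (hfc : Continuous f) (hgc : Continuous g) : MeanLE (fun t => f t + g t) (c + d) := by
  intro ε hε
  filter_upwards [hf (ε / 2) (by positivity), hg (ε / 2) (by positivity)] with T h1 h2
  have := avg_add hfc hgc T
  simp only [Pi.add_def] at this
  rw [this]
  linarith

theorem avg_const_mul (k : ℝ) (f : ℝ → ℝ) (T : ℝ) : avg (fun t => k * f t) T = k * avg f T := by
  simp only [avg, intervalIntegral.integral_const_mul, smul_eq_mul]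
  ring

theorem MeanLE.const_mul {f : ℝ → ℝ} {c : ℝ} (hf : MeanLE f c) {k : ℝ} (hk : 0 < k) :
    MeanLE (fun t => k * f t) (k * c) := by
  intro ε hε
  filter_upwards [hf (ε / k) (by positivity)] with T h1
  rw [avg_const_mul]
  calc _ ≤ k * (c + ε / k) := by gcongr
    _ = _ := by field_simp

theorem meanLE_const (c : ℝ) : MeanLE (fun _ => c) c := by
  intro ε hε
  filter_upwards [eventually_gt_atTop 0] with T hT
  rw [avg_const hT]
  linarith

/-! ### Trigonometric polynomials: majorants and analytic completions -/

theorem tendsto_avg_re {F : ℝ → ℂ} (hF : Continuous F) {a : ℂ} (h : Tendsto (avg F) atTop (𝓝 a)) :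
    Tendsto (avg fun t => (F t).re) atTop (𝓝 a.re) := by
  refine ((Complex.continuous_re.tendsto a).comp h).congr fun T => ?_
  have h1 := Complex.reCLM.intervalIntegral_comp_comm (hF.intervalIntegrable (μ := volume) (-T) T)
  simp only [Complex.reCLM_apply] at h1
  simp only [Function.comp, avg, h1, Complex.smul_re]

theorem polynomial_mem_trigAlg {f : ℝ → ℂ} (hf : f ∈ trigAlg) (Q : Polynomial ℂ) :
    (fun t => Q.eval (f t)) ∈ trigAlg := by
  have h1 : Polynomial.aeval f Q ∈ trigAlg := Algebra.adjoin_le (Set.singleton_subset_iff.mpr hf)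
    (Polynomial.aeval_mem_adjoin_singleton ℂ _)
  convert h1 using 1
  ext t
  exact (Polynomial.aeval_algHom_apply (Pi.evalAlgHom ℂ (fun _ : ℝ => ℂ) t) f Q)

theorem const_mem_trigAlg (c : ℂ) : (fun _ => c : ℝ → ℂ) ∈ trigAlg := algebraMap_mem trigAlg c

/-- A positive trigonometric majorant of `|u|`. -/
theorem exists_trig_majorant {u : ℝ → ℝ} (hu : (fun t => (u t : ℂ)) ∈ trigAlg) {η : ℝ}
    (hη : 0 < η) : ∃ h : ℝ → ℝ, (fun t => (h t : ℂ)) ∈ trigAlg ∧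
      ∀ t, |u t| + η ≤ h t ∧ h t ≤ |u t| + 3 * η := by
  obtain ⟨M, hM⟩ := trigAlg_bounded hu
  simp only [Complex.norm_real, Real.norm_eq_abs] at hM
  -- Approximating the square root at `u²` gives `|u|` up to `η`; the shift by `2η` then makes the
  -- error one-sided.
  obtain ⟨P, hP⟩ := exists_polynomial_near_of_continuousOn 0 (M ^ 2) Real.sqrt
    Real.continuous_sqrt.continuousOn η hη
  refine ⟨fun t => P.eval (u t ^ 2) + 2 * η, ?_, fun t => ?_⟩
  · have h1 := add_mem (polynomial_mem_trigAlg (pow_mem hu 2) (P.map Complex.ofRealHom))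
      (const_mem_trigAlg (2 * η))
    convert h1 using 1
    ext t
    have h2 : (P.map Complex.ofRealHom).eval ((u t ^ 2 : ℝ) : ℂ) = (P.eval (u t ^ 2) : ℝ) :=
      Polynomial.eval_map_apply (f := Complex.ofRealHom) (u t ^ 2)
    simp only [Pi.add_apply, Pi.pow_apply]
    rw [← Complex.ofReal_pow, h2]
    push_cast
    rfl
  · have h1 := hP (u t ^ 2) ⟨by positivity, by
      rw [← sq_abs]
      gcongr
      exact hM t⟩
    rw [Real.sqrt_sq_eq_abs, abs_lt] at h1
    constructor <;> linarith [h1.1, h1.2]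

/-- Frequencies are sorted by sign; the negative ones are conjugates of positive ones. -/
theorem exists_decomposition {f : ℝ → ℂ} (hf : f ∈ trigAlg) :
    ∃ (a : ℂ) (G H : ℝ → ℂ), G ∈ posFreq ∧ H ∈ posFreq ∧ ∀ t, f t = a + G t + star (H t) := by
  refine trigAlg_induction (P := fun f => ∃ (a : ℂ) (G H : ℝ → ℂ), G ∈ posFreq ∧ H ∈ posFreq ∧
    ∀ t, f t = a + G t + star (H t)) ?_ ?_ ?_ ?_ hf
  · intro w
    rcases lt_trichotomy (0 : ℝ) w.toAdd with hw | hw | hw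
    · exact ⟨0, osc w, 0, Submodule.subset_span ⟨w, hw, rfl⟩, zero_mem _, by simp⟩
    · have : w = 1 := (toAdd_eq_zero.mp hw.symm)
      subst this
      exact ⟨1, 0, 0, zero_mem _, zero_mem _, by simp⟩
    · refine ⟨0, 0, osc w⁻¹, zero_mem _, Submodule.subset_span ⟨w⁻¹, ?_, rfl⟩, fun t => ?_⟩
      · simpa using hw
      · rw [← Pi.star_apply, star_osc]
        simp
  · exact ⟨0, 0, 0, zero_mem _, zero_mem _, by simp⟩
  · rintro f g ⟨a, G, H, hG, hH, h⟩ ⟨a', G', H', hG', hH', h'⟩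
    refine ⟨a + a', G + G', H + H', add_mem hG hG', add_mem hH hH', fun t => ?_⟩
    simp only [Pi.add_apply, h, h', star_add]
    ring
  · rintro c f ⟨a, G, H, hG, hH, h⟩
    refine ⟨c * a, c • G, star c • H, Submodule.smul_mem _ _ hG, Submodule.smul_mem _ _ hH,
      fun t => ?_⟩
    simp only [Pi.smul_apply, smul_eq_mul, h, star_mul', star_star]
    ring

/-- Conjugating `star H` into `H` does not change real parts and removes the negative frequencies.
-/
theorem completion_re {g G H : ℝ → ℂ} {a : ℂ} (hG : G ∈ posFreq) (hH : H ∈ posFreq)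
    (h : ∀ t, g t = a + G t + star (H t)) :
    ((fun t => a.re + (G t + H t)), (a.re : ℂ)) ∈ analyticGraph ∧
      ∀ t, ((a.re : ℂ) + (G t + H t)).re = (g t).re := by
  refine ⟨?_, fun t => ?_⟩
  · rw [mem_analyticGraph]
    convert add_mem hG hH using 1
    ext t; simp
  · rw [h]
    simp
    ring

/-- The same device for `-i g`, whose real part is the imaginary part of `g`. -/
theorem completion_im {g G H : ℝ → ℂ} {a : ℂ} (hG : G ∈ posFreq) (hH : H ∈ posFreq)
    (h : ∀ t, g t = a + G t + star (H t)) :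
    ((fun t => a.im + -Complex.I * (G t - H t)), (a.im : ℂ)) ∈ analyticGraph ∧
      ∀ t, ((a.im : ℂ) + -Complex.I * (G t - H t)).re = (g t).im := by
  refine ⟨?_, fun t => ?_⟩
  · rw [mem_analyticGraph]
    convert Submodule.smul_mem _ (-Complex.I) (sub_mem hG hH) using 1
    ext t; simp
  · rw [h]
    simp
    ring

theorem exists_completion {u : ℝ → ℝ} (hu : (fun t => (u t : ℂ)) ∈ trigAlg) :
    ∃ (F : ℝ → ℂ) (a : ℝ), (F, (a : ℂ)) ∈ analyticGraph ∧ ∀ t, (F t).re = u t := by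
  obtain ⟨a, G, H, hG, hH, h⟩ := exists_decomposition hu
  exact ⟨_, _, completion_re hG hH h⟩

theorem bounded_of_mem_analyticGraph {F : ℝ → ℂ} {a : ℂ} (h : (F, a) ∈ analyticGraph) :
    ∃ M, ∀ t, ‖F t‖ ≤ M := by
  have h1 := add_mem (posFreq_le_trigAlg (mem_analyticGraph.mp h)) (const_mem_trigAlg a)
  obtain ⟨M, hM⟩ := trigAlg_bounded h1
  exact ⟨M, fun t => by simpa using hM t⟩

/-! ### Kolmogorov's inequality -/

/-- Kolmogorov's inequality for functions with positive real part. -/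
theorem meanLE_rpow_of_re_pos {p : ℝ} (hp : 0 < p) (hp1 : p < 1) {F : ℝ → ℂ} {a : ℝ}
    (h : (F, (a : ℂ)) ∈ analyticGraph) {δ : ℝ} (hδ : 0 < δ) (hre : ∀ t, δ ≤ (F t).re) {c : ℝ}
    (hc : MeanLE (fun t => (F t).re) c) :
    MeanLE (fun t => ‖F t‖ ^ p) (c ^ p / (1 - p)) := by
  have hF := continuous_of_mem_analyticGraph h
  obtain ⟨M, hM⟩ := bounded_of_mem_analyticGraph h
  have hmean := tendsto_avg_re hF (mean_of_mem_analyticGraph h)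
  rw [Complex.ofReal_re] at hmean
  have hac : a ≤ c := hc.le_of_tendsto_avg hmean
  have ha : 0 ≤ a := by
    refine ge_of_tendsto hmean ?_
    filter_upwards [eventually_gt_atTop 0] with T hT
    rw [← avg_const hT 0]
    exact avg_mono continuous_const (Complex.continuous_re.comp hF)
      (fun t => hδ.le.trans (hre t)) hT
  have hcp : Continuous (fun t => F t ^ (p : ℂ)) :=
    hF.cpow continuous_const fun t => Or.inl (hδ.trans_le (hre t))
  have h1 := MeanLE.of_tendsto_avg (tendsto_avg_re hcp (mean_cpow p h hδ hre hM))
  rw [← Complex.ofReal_cpow ha, Complex.ofReal_re] at h1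
  have hq : 0 < 1 - p := by linarith
  have h2 := h1.const_mul (inv_pos.mpr hq)
  -- Pointwise, `(1 - p) |F|^p ≤ Re F^p`, and the mean of the right-hand side is `a ^ p`.
  have h3 : MeanLE (fun t => ‖F t‖ ^ p) ((1 - p)⁻¹ * a ^ p) := by
    refine h2.mono (hF.norm.rpow_const fun _ => Or.inr hp.le)
      (continuous_const.mul (Complex.continuous_re.comp hcp)) fun t => ?_
    have h4 := cos_mul_norm_rpow_le hp hp1 (hδ.trans_le (hre t))
    have h5 := one_sub_le_cos hp hp1
    rw [inv_mul_eq_div, le_div_iff₀ hq, mul_comm]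
    refine le_trans ?_ h4
    gcongr
  intro ε hε
  filter_upwards [h3 ε hε] with T hT
  refine hT.trans ?_
  rw [inv_mul_eq_div]
  gcongr

/-- Kolmogorov's inequality for real trigonometric polynomials. -/
theorem meanLE_rpow_completion {p : ℝ} (hp : 0 < p) (hp1 : p < 1) {F : ℝ → ℂ} {a : ℝ}
    (h : (F, (a : ℂ)) ∈ analyticGraph) (hu : (fun t => ((F t).re : ℂ)) ∈ trigAlg) {c : ℝ}
    (hc0 : 0 ≤ c) (hc : MeanLE (fun t => |(F t).re|) c) :
    MeanLE (fun t => ‖F t‖ ^ p) (2 * c ^ p / (1 - p)) := by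
  have hF := continuous_of_mem_analyticGraph h
  have hre : Continuous fun t => (F t).re := Complex.continuous_re.comp hF
  have hφ : Tendsto (fun η : ℝ => 2 * (c + 3 / 2 * η) ^ p / (1 - p)) (𝓝[>] 0)
      (𝓝 (2 * c ^ p / (1 - p))) := by
    refine tendsto_nhdsWithin_of_tendsto_nhds ?_
    have h1 : Continuous (fun η : ℝ => 2 * (c + 3 / 2 * η) ^ p / (1 - p)) :=
      ((continuous_const.mul ((continuous_const.add (continuous_const.mul continuous_id)).rpow_const
        fun _ => Or.inr hp.le)).div_const _)
    simpa using h1.tendsto 0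
  refine MeanLE.of_tendsto (fun η hη => ?_) hφ
  -- The positive and negative parts of `Re F` need not be trigonometric polynomials. A
  -- trigonometric majorant `m` of `|Re F|`, completed to `K`, replaces them: `K + F` and `K - F`
  -- have real parts between `η` and `2 |Re F| + 3η`.
  obtain ⟨m, hm, hmu⟩ := exists_trig_majorant hu hη
  obtain ⟨K, b, hK, hKm⟩ := exists_completion hm
  have hKc := continuous_of_mem_analyticGraph hK
  have hsum : MeanLE (fun t => 2 * |(F t).re| + 3 * η) (2 * c + 3 * η) :=
    (hc.const_mul two_pos).add (meanLE_const _) (continuous_const.mul hre.abs) continuous_const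
  have hsc : Continuous (fun t => 2 * |(F t).re| + 3 * η) :=
    (continuous_const.mul hre.abs).add continuous_const
  have key : ∀ (L : ℝ → ℂ) (d : ℝ), (L, (d : ℂ)) ∈ analyticGraph →
      (∀ t, |(L t).re| = |(F t).re|) →
      MeanLE (fun t => ‖(K + L) t‖ ^ p) ((2 * c + 3 * η) ^ p / (1 - p)) := by
    intro L d hL hLF
    have h1 : (K + L, ((b + d : ℝ) : ℂ)) ∈ analyticGraph := by
      rw [Complex.ofReal_add]
      exact add_mem hK hL
    refine meanLE_rpow_of_re_pos hp hp1 h1 hη (fun t => ?_) (hsum.mono ?_ hsc fun t => ?_)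
    · have h2 := (hmu t).1
      have h3 := (abs_le.mp (hLF t).le).1
      rw [Pi.add_apply, Complex.add_re, hKm]
      linarith
    · exact Complex.continuous_re.comp (continuous_of_mem_analyticGraph h1)
    · have h2 := (hmu t).2
      have h3 := (abs_le.mp (hLF t).le).2
      rw [Pi.add_apply, Complex.add_re, hKm]
      linarith
  have hneg : (-F, ((-a : ℝ) : ℂ)) ∈ analyticGraph := by
    rw [Complex.ofReal_neg]
    exact neg_mem h
  have h1 := key F a h fun t => rfl
  have h2 := key (-F) (-a) hneg fun t => by simp
  have hc1 : Continuous (fun t => ‖(K + F) t‖ ^ p) :=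
    (hKc.add hF).norm.rpow_const fun _ => Or.inr hp.le
  have hc2 : Continuous (fun t => ‖(K + -F) t‖ ^ p) :=
    (hKc.add hF.neg).norm.rpow_const fun _ => Or.inr hp.le
  have h3 := (h1.add h2 hc1 hc2).const_mul (show (0 : ℝ) < 2⁻¹ ^ p by positivity)
  have e : 2⁻¹ ^ p * ((2 * c + 3 * η) ^ p / (1 - p) + (2 * c + 3 * η) ^ p / (1 - p))
      = 2 * (c + 3 / 2 * η) ^ p / (1 - p) := by
    have : (c + 3 / 2 * η) = 2⁻¹ * (2 * c + 3 * η) := by ring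
    rw [this, Real.mul_rpow (by positivity) (by positivity)]
    ring
  rw [e] at h3
  refine h3.mono (hF.norm.rpow_const fun _ => Or.inr hp.le)
    (continuous_const.mul (hc1.add hc2)) fun t => ?_
  have h4 : ‖F t‖ ≤ 2⁻¹ * (‖(K + F) t‖ + ‖(K + -F) t‖) := by
    have h5 : F t = 2⁻¹ * ((K + F) t - (K + -F) t) := by
      simp only [Pi.add_apply, Pi.neg_apply]
      ring
    calc ‖F t‖ = 2⁻¹ * ‖(K + F) t - (K + -F) t‖ := by
          rw [h5, norm_mul]
          norm_num
      _ ≤ _ := by gcongr; exact norm_sub_le _ _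
  calc ‖F t‖ ^ p ≤ (2⁻¹ * (‖(K + F) t‖ + ‖(K + -F) t‖)) ^ p := by gcongr
    _ = 2⁻¹ ^ p * (‖(K + F) t‖ + ‖(K + -F) t‖) ^ p := Real.mul_rpow (by positivity) (by positivity)
    _ ≤ _ := by
      gcongr
      exact Real.rpow_add_le_add_rpow (norm_nonneg _) (norm_nonneg _) hp.le hp1.le

/-- Kolmogorov's inequality for the projection onto the nonnegative frequencies. -/
theorem meanLE_rpow_projection {p : ℝ} (hp : 0 < p) (hp1 : p < 1) {g G H : ℝ → ℂ} {a : ℂ}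
    (hg : g ∈ trigAlg) (hG : G ∈ posFreq) (hH : H ∈ posFreq)
    (h : ∀ t, g t = a + G t + star (H t)) {c : ℝ} (ha : ‖a‖ ≤ c)
    (hc : MeanLE (fun t => ‖g t‖) c) :
    MeanLE (fun t => ‖a + G t‖ ^ p) (5 * c ^ p / (1 - p)) := by
  have hc0 : 0 ≤ c := (norm_nonneg a).trans ha
  have hgc := trigAlg_continuous hg
  have hGc := trigAlg_continuous (posFreq_le_trigAlg hG)
  obtain ⟨h1, h1'⟩ := completion_re hG hH h
  obtain ⟨h2, h2'⟩ := completion_im hG hH h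
  have hre : (fun t => ((g t).re : ℂ)) ∈ trigAlg := by
    convert Subalgebra.smul_mem _ (add_mem hg (star_mem hg)) (2⁻¹ : ℂ) using 1
    ext t
    simp only [Pi.smul_apply, Pi.add_apply, Pi.star_apply, RCLike.star_def, smul_eq_mul,
      Complex.add_conj]
    push_cast
    ring
  have him : (fun t => ((g t).im : ℂ)) ∈ trigAlg := by
    convert Subalgebra.smul_mem _ (sub_mem hg (star_mem hg)) (-Complex.I * 2⁻¹ : ℂ) using 1
    ext t
    simp only [Pi.smul_apply, Pi.sub_apply, Pi.star_apply, RCLike.star_def, smul_eq_mul,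
      Complex.sub_conj]
    push_cast
    linear_combination ((g t).im : ℂ) * Complex.I_sq
  have k1 := meanLE_rpow_completion hp hp1 h1 (by simpa only [h1'] using hre) hc0
    (hc.mono (by simpa only [h1', Function.comp_def] using (Complex.continuous_re.comp hgc).abs) hgc.norm fun t => by
      rw [h1']
      exact Complex.abs_re_le_norm _)
  have k2 := meanLE_rpow_completion hp hp1 h2 (by simpa only [h2'] using him) hc0
    (hc.mono (by simpa only [h2', Function.comp_def] using (Complex.continuous_im.comp hgc).abs) hgc.norm fun t => by
      rw [h2']
      exact Complex.abs_im_le_norm _)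
  have c1 : Continuous fun t => ‖(a.re : ℂ) + (G t + H t)‖ ^ p :=
    (continuous_of_mem_analyticGraph h1).norm.rpow_const fun _ => Or.inr hp.le
  have c2 : Continuous fun t => ‖(a.im : ℂ) + -Complex.I * (G t - H t)‖ ^ p :=
    (continuous_of_mem_analyticGraph h2).norm.rpow_const fun _ => Or.inr hp.le
  have k3 := (meanLE_const (c ^ p)).add (k1.add k2 c1 c2) continuous_const (c1.add c2)
  have k4 : MeanLE (fun t => ‖a + G t‖ ^ p)
      (c ^ p + (2 * c ^ p / (1 - p) + 2 * c ^ p / (1 - p))) := by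
    refine k3.mono ((continuous_const.add hGc).norm.rpow_const fun _ => Or.inr hp.le)
      (continuous_const.add (c1.add c2)) fun t => ?_
    -- The completions of `Re g` and `Im g` combine to `a + 2G`, so the constant term has to be
    -- added once more before halving. This yields the constant `5 = 1 + 2 + 2`.
    have e : a + G t = 2⁻¹ * (a + ((a.re + (G t + H t))
        + Complex.I * (a.im + -Complex.I * (G t - H t)))) := by
      linear_combination (-2⁻¹ : ℂ) * Complex.re_add_im a
        + (2⁻¹ * (G t - H t)) * Complex.I_sq
    have e2 : ‖a + G t‖ ≤ c + (‖(a.re : ℂ) + (G t + H t)‖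
        + ‖(a.im : ℂ) + -Complex.I * (G t - H t)‖) := by
      rw [e, norm_mul]
      have n1 := norm_add_le a ((a.re + (G t + H t))
        + Complex.I * (a.im + -Complex.I * (G t - H t)))
      have n2 := norm_add_le ((a.re : ℂ) + (G t + H t))
        (Complex.I * (a.im + -Complex.I * (G t - H t)))
      rw [norm_mul Complex.I, Complex.norm_I, one_mul] at n2
      have n3 : ‖(2⁻¹ : ℂ)‖ = 2⁻¹ := by norm_num
      rw [n3]
      linarith [norm_nonneg (a + ((a.re + (G t + H t))
        + Complex.I * (a.im + -Complex.I * (G t - H t))))]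
    calc ‖a + G t‖ ^ p ≤ (c + (‖(a.re : ℂ) + (G t + H t)‖
        + ‖(a.im : ℂ) + -Complex.I * (G t - H t)‖)) ^ p := by gcongr
      _ ≤ c ^ p + (‖(a.re : ℂ) + (G t + H t)‖
        + ‖(a.im : ℂ) + -Complex.I * (G t - H t)‖) ^ p :=
        Real.rpow_add_le_add_rpow hc0 (by positivity) hp.le hp1.le
      _ ≤ _ := by
        gcongr
        exact Real.rpow_add_le_add_rpow (norm_nonneg _) (norm_nonneg _) hp.le hp1.le
  intro ε hε
  filter_upwards [k4 ε hε] with T hT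
  refine hT.trans ?_
  have hq : 0 < 1 - p := by linarith
  have h6 : c ^ p ≤ c ^ p / (1 - p) := by
    rw [le_div_iff₀ hq]
    nlinarith [Real.rpow_nonneg hc0 p]
  have e : 5 * c ^ p / (1 - p) = c ^ p / (1 - p)
    + (2 * c ^ p / (1 - p) + 2 * c ^ p / (1 - p)) := by ring
  rw [e]
  gcongr

/-! ### Partial sums as rotated projections -/

variable {l : Frequency}

theorem bdry_add (D E : DirichletPolynomial l) (t : ℝ) :
    (D + E).bdry t = D.bdry t + E.bdry t := eval_add _ _ _

theorem osc_mul_bdry (D : DirichletPolynomial l) (w t : ℝ) :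
    osc (Multiplicative.ofAdd w) t * D.bdry t
      = ∑ n ∈ Finsupp.support D, D.coeff n * osc (Multiplicative.ofAdd (w - l.val n)) t := by
  rw [bdry_eq, Finset.sum_apply, Finset.mul_sum]
  refine Finset.sum_congr rfl fun n _ => ?_
  rw [sub_eq_add_neg, ofAdd_add, map_mul]
  simp only [Pi.smul_apply, Pi.mul_apply, smul_eq_mul]
  ring

theorem coeff_ne_zero_of_mem {D : DirichletPolynomial l} {n : ℕ} (hn : n ∈ Finsupp.support D) :
    D.coeff n ≠ 0 := Finsupp.mem_support_iff.mp hn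

/-- A polynomial of length `N + 1`, rotated by its last frequency, has nonnegative frequencies. -/
theorem exists_posFreq_of_length (D : DirichletPolynomial l) {N : ℕ}
    (hD : ∀ n, N < n → D.coeff n = 0) :
    ∃ G ∈ posFreq, ∀ t, osc (Multiplicative.ofAdd (l.val N)) t * D.bdry t = D.coeff N + G t := by
  refine ⟨∑ n ∈ (Finsupp.support D).erase N,
    D.coeff n • osc (Multiplicative.ofAdd (l.val N - l.val n)), ?_, fun t => ?_⟩
  · refine Submodule.sum_mem _ fun n hn => Submodule.smul_mem _ _ (Submodule.subset_span ⟨_, ?_, rfl⟩)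
    obtain ⟨hnN, hn⟩ := Finset.mem_erase.mp hn
    have h1 : n ≤ N := not_lt.mp fun h => coeff_ne_zero_of_mem hn (hD n h)
    exact sub_pos.mpr (l.strictMono (lt_of_le_of_ne h1 hnN))
  · rw [osc_mul_bdry, Finset.sum_apply]
    simp only [Pi.smul_apply, smul_eq_mul]
    have e : D.coeff N = D.coeff N * osc (Multiplicative.ofAdd (l.val N - l.val N)) t := by simp
    by_cases hN : N ∈ Finsupp.support D
    · rw [← Finset.add_sum_erase _ _ hN, ← e]
    · rw [Finset.erase_eq_of_notMem hN, show D.coeff N = 0 from Finsupp.notMem_support_iff.mp hN,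
        zero_add]

/-- A polynomial with vanishing first coefficients, suitably rotated, has negative frequencies. -/
theorem exists_star_posFreq_of_coeff_eq_zero (D : DirichletPolynomial l) {N : ℕ}
    (hD : ∀ n, n ≤ N → D.coeff n = 0) :
    ∃ H ∈ posFreq, ∀ t, osc (Multiplicative.ofAdd (l.val N)) t * D.bdry t = star (H t) := by
  refine ⟨∑ n ∈ Finsupp.support D,
    star (D.coeff n) • osc (Multiplicative.ofAdd (l.val n - l.val N)), ?_, fun t => ?_⟩
  · refine Submodule.sum_mem _ fun n hn => Submodule.smul_mem _ _ (Submodule.subset_span ⟨_, ?_, rfl⟩)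
    exact sub_pos.mpr (l.strictMono (not_le.mp fun h => coeff_ne_zero_of_mem hn (hD n h)))
  · rw [osc_mul_bdry, Finset.sum_apply, star_sum]
    refine Finset.sum_congr rfl fun n _ => ?_
    rw [Pi.smul_apply, smul_eq_mul, star_mul', star_star, ← Pi.star_apply, star_osc, ← ofAdd_neg,
      neg_sub]

/-- The `N`-th partial sum of a Dirichlet polynomial. -/
noncomputable def cut (D : DirichletPolynomial l) (N : ℕ) : DirichletPolynomial l :=
  ∑ n ∈ Finset.range N, D.coeff n • monomial l n

theorem coeff_monomial (k n : ℕ) : (monomial l k).coeff n = if k = n then 1 else 0 :=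
  Finsupp.single_apply

theorem coeff_cut (D : DirichletPolynomial l) (N n : ℕ) :
    (D.cut N).coeff n = if n < N then D.coeff n else 0 := by
  have e : (D.cut N).coeff n = ∑ k ∈ Finset.range N, D.coeff k * (monomial l k).coeff n := by
    simp only [cut, coeff, map_sum, map_smul, smul_eq_mul]
  rw [e]
  simp [coeff_monomial]

/-- After rotation by `exp (iλ_N t)`, index `N` carries the constant term, smaller indices the
positive frequencies and larger ones the negative frequencies. The cut at `N + 1` keeps indices `0`
to `N`, hence is exactly the projection. -/
theorem meanLE_cut_rpow (D : DirichletPolynomial l) (N : ℕ) {p : ℝ} (hp : 0 < p) (hp1 : p < 1) :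
    MeanLE (fun t => ‖(D.cut (N + 1)).bdry t‖ ^ p) (5 * D.hardyNorm 1 ^ p / (1 - p)) := by
  set w := Multiplicative.ofAdd (l.val N)
  have hS : (D.cut (N + 1)).coeff N = D.coeff N := by simp [coeff_cut]
  obtain ⟨G, hG, hGS⟩ := (D.cut (N + 1)).exists_posFreq_of_length (N := N) fun n hn => by
    rw [coeff_cut, if_neg (by omega)]
  obtain ⟨H, hH, hHS⟩ := (D - D.cut (N + 1)).exists_star_posFreq_of_coeff_eq_zero (N := N)
    fun n hn => by
      have : (D - D.cut (N + 1)).coeff n = D.coeff n - (D.cut (N + 1)).coeff n := map_sub _ _ _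
      rw [this, coeff_cut, if_pos (by omega), sub_self]
  have hg : osc w * D.bdry ∈ trigAlg := mul_mem (osc_mem w) D.bdry_mem
  have h := meanLE_rpow_projection hp hp1 (a := D.coeff N) (c := D.hardyNorm 1) hg hG hH
    (fun t => by
      rw [← hHS, ← hS, ← hGS, ← mul_add, ← bdry_add, add_sub_cancel]
      rfl) (D.norm_coeff_le N) (by
      simp only [Pi.mul_apply, norm_mul, norm_osc, one_mul]
      exact MeanLE.of_tendsto_avg D.tendsto_hardyNorm_one)
  simpa only [← hS, ← hGS, norm_mul, norm_osc, one_mul] using h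

/-! ### Comparison of the norms `‖·‖_1` and `‖·‖_2` -/

theorem hardyNorm_two_nonneg (D : DirichletPolynomial l) : 0 ≤ D.hardyNorm 2 := by
  rw [hardyNorm_def, ← Real.sqrt_eq_rpow]
  exact Real.sqrt_nonneg _

theorem tendsto_hardyNorm_two (D : DirichletPolynomial l) :
    Tendsto (avg (fun t => ‖D.bdry t‖ ^ 2)) atTop (𝓝 (D.hardyNorm 2 ^ 2)) := by
  have h := D.tendsto_hardyNorm two_pos
  simp only [Real.rpow_two] at h
  exact h

/-- Each coefficient is at most `‖D‖_1`, so `|D| ≤ N ‖D‖_1` on the imaginary axis; one factor of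
`|D|²` is bounded this way and the other is averaged. -/
theorem hardyNorm_two_sq_le (D : DirichletPolynomial l) {N : ℕ}
    (hD : ∀ n, N ≤ n → D.coeff n = 0) : D.hardyNorm 2 ^ 2 ≤ N * D.hardyNorm 1 ^ 2 := by
  have hb : ∀ t, ‖D.bdry t‖ ≤ N * D.hardyNorm 1 := by
    intro t
    have hs : Finsupp.support D ⊆ Finset.range N := fun n hn => Finset.mem_range.mpr
      (not_le.mp fun h => coeff_ne_zero_of_mem hn (hD n h))
    have h0 : 0 ≤ D.hardyNorm 1 := (norm_nonneg _).trans (D.norm_coeff_le 0)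
    rw [bdry_eq, Finset.sum_apply]
    calc _ ≤ ∑ n ∈ Finsupp.support D, D.hardyNorm 1 := by
          refine norm_sum_le_of_le _ fun n _ => ?_
          rw [Pi.smul_apply, norm_smul, norm_osc, mul_one]
          exact D.norm_coeff_le n
      _ ≤ ∑ n ∈ Finset.range N, D.hardyNorm 1 :=
          Finset.sum_le_sum_of_subset_of_nonneg hs fun _ _ _ => h0
      _ = _ := by simp
  have hc := D.bdry_continuous.norm
  refine le_of_tendsto_of_tendsto D.tendsto_hardyNorm_two
    (D.tendsto_hardyNorm_one.const_mul (N * D.hardyNorm 1)) ?_ |>.trans_eq (by ring)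
  filter_upwards [eventually_gt_atTop 0] with T hT
  rw [← avg_const_mul]
  refine avg_mono (hc.pow 2) (continuous_const.mul hc) (fun t => ?_) hT
  rw [sq]
  exact mul_le_mul_of_nonneg_right (hb t) (norm_nonneg _)

theorem hardyNorm_one_pos {D : DirichletPolynomial l} (hD : D ≠ 0) : 0 < D.hardyNorm 1 :=
  norm_pos_iff.mpr hD

theorem ratio_le_sqrt {N : ℕ} {r : ℝ} (hr : r ∈ hardyRatios l N) : r ≤ √N := by
  obtain ⟨D, hD0, hD, rfl⟩ := hr
  have h1 := hardyNorm_one_pos hD0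
  rw [div_le_iff₀ h1]
  refine le_of_sq_le_sq ?_ (by positivity)
  rw [mul_pow, Real.sq_sqrt (Nat.cast_nonneg N)]
  exact D.hardyNorm_two_sq_le hD

theorem bddAbove_hardyRatios (l : Frequency) (N : ℕ) : BddAbove (hardyRatios l N) :=
  ⟨√N, fun _ hr => ratio_le_sqrt hr⟩

theorem hardyRatioSup_le_sqrt (l : Frequency) (N : ℕ) : hardyRatioSup l N ≤ √N :=
  Real.sSup_le (fun _ hr => ratio_le_sqrt hr) (Real.sqrt_nonneg _)

theorem hardyNorm_two_le {D : DirichletPolynomial l} (hD0 : D ≠ 0) {N : ℕ}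
    (hD : ∀ n, N ≤ n → D.coeff n = 0) :
    D.hardyNorm 2 ≤ hardyRatioSup l N * D.hardyNorm 1 := by
  rw [← div_le_iff₀ (hardyNorm_one_pos hD0)]
  exact le_csSup (bddAbove_hardyRatios l N) ⟨D, hD0, hD, rfl⟩

theorem tendsto_avg_cos {w : ℝ} (hw : w ≠ 0) :
    Tendsto (avg fun t => Real.cos (w * t)) atTop (𝓝 0) := by
  have h := tendsto_avg_re (trigAlg_continuous (osc_mem (Multiplicative.ofAdd w)))
    (avg_osc (Multiplicative.ofAdd w))
  rw [if_neg (by simpa using hw), Complex.zero_re] at h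
  refine h.congr fun T => ?_
  congr 1
  ext t
  simp only [osc, MonoidHom.coe_mk, OneHom.coe_mk, toAdd_ofAdd, Complex.exp_ofReal_mul_I_re]

theorem tendsto_avg_cos_combination {w : ℝ} (hw : w ≠ 0) (a b c : ℝ) :
    Tendsto (avg fun t => a + (b * Real.cos (w * t) + c * Real.cos (w * t) ^ 2)) atTop
      (𝓝 (a + c / 2)) := by
  have e : (fun t => a + (b * Real.cos (w * t) + c * Real.cos (w * t) ^ 2))
      = (fun _ => a + c / 2) + ((fun t => b * Real.cos (w * t))
        + fun t => (c / 2) * Real.cos (2 * w * t)) := by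
    ext t
    simp only [Pi.add_apply]
    rw [Real.cos_sq, mul_assoc 2 w t]
    ring
  have h1 := ((tendsto_avg_cos hw).const_mul b).add
    ((tendsto_avg_cos (mul_ne_zero two_ne_zero hw)).const_mul (c / 2))
  simp only [mul_zero, add_zero] at h1
  have h2 := h1.const_add (a + c / 2)
  rw [add_zero] at h2
  refine h2.congr' ?_
  filter_upwards [eventually_gt_atTop 0] with T hT
  rw [e, avg_add continuous_const (by fun_prop), avg_add (by fun_prop) (by fun_prop), avg_const hT,
    avg_const_mul, avg_const_mul]

/-- The quadratic term makes the bound strict in mean: at `y = cos (wt)` the right-hand side has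
mean `1 - 1 / 32`, which is the source of `32 / 31`. -/
theorem sqrt_one_add_le {y : ℝ} (h1 : -1 ≤ y) (h2 : y ≤ 1) :
    √(1 + y) ≤ 1 + (1 / 2 * y + -1 / 16 * y ^ 2) := by
  refine Real.sqrt_le_iff.mpr ⟨by nlinarith, ?_⟩
  nlinarith [mul_nonneg (sq_nonneg y) (show 0 ≤ 1 - y by linarith), sq_nonneg (y ^ 2), sq_nonneg y]

/-- The ratios of two-term polynomials are bounded away from `1`. -/
theorem le_hardyRatioSup (l : Frequency) {N : ℕ} (hN : 2 ≤ N) : 32 / 31 ≤ hardyRatioSup l N := by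
  set w := l.val 1 - l.val 0
  have hw : w ≠ 0 := (sub_pos.mpr (l.strictMono zero_lt_one)).ne'
  set D : DirichletPolynomial l := monomial l 0 + monomial l 1
  have hcoeff : ∀ n, D.coeff n = (if 0 = n then 1 else 0) + (if 1 = n then 1 else 0) := by
    intro n
    rw [← coeff_monomial (l := l), ← coeff_monomial (l := l)]
    exact map_add _ _ _
  have hD0 : D ≠ 0 := by
    intro h
    have h1 := hcoeff 0
    rw [h] at h1
    have h2 : (0 : DirichletPolynomial l).coeff 0 = 0 := map_zero _
    rw [h2] at h1
    norm_num at h1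
  have hlen : ∀ n, N ≤ n → D.coeff n = 0 := by
    intro n hn
    rw [hcoeff, if_neg (by omega), if_neg (by omega), add_zero]
  have hmon : ∀ n t, (monomial l n).bdry t
      = Complex.exp ((-(l.val n * t) : ℝ) * Complex.I) := by
    intro n t
    have : (monomial l n).bdry t = (1 : ℂ) • Complex.exp (-(l.val n : ℂ) * (t * Complex.I)) :=
      Finsupp.linearCombination_single ℂ 1 n
    rw [this, one_smul]
    congr 1
    push_cast
    ring
  have hsq : ∀ t, ‖D.bdry t‖ ^ 2 = 2 * (1 + Real.cos (w * t)) := by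
    intro t
    rw [bdry_add, hmon, hmon, ← Complex.normSq_eq_norm_sq, Complex.normSq_apply]
    simp only [Complex.add_re, Complex.add_im, Complex.exp_ofReal_mul_I_re,
      Complex.exp_ofReal_mul_I_im]
    have e : w * t = -(l.val 0 * t) - -(l.val 1 * t) := by ring
    rw [e, Real.cos_sub]
    linear_combination Real.sin_sq_add_cos_sq (-(l.val 0 * t))
      + Real.sin_sq_add_cos_sq (-(l.val 1 * t))
  have h2 : D.hardyNorm 2 ^ 2 = 2 := by
    refine tendsto_nhds_unique D.tendsto_hardyNorm_two ?_
    convert tendsto_avg_cos_combination hw 2 2 0 using 2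
    · ext t
      rw [hsq]
      ring
    · norm_num
  have h2' : D.hardyNorm 2 = √2 := by
    rw [← Real.sqrt_sq D.hardyNorm_two_nonneg, h2]
  have h1 : D.hardyNorm 1 ≤ √2 * (31 / 32) := by
    have h3 := (tendsto_avg_cos_combination hw 1 (1 / 2) (-1 / 16)).const_mul √2
    refine (le_of_tendsto_of_tendsto D.tendsto_hardyNorm_one h3 ?_).trans_eq (by ring)
    filter_upwards [eventually_gt_atTop 0] with T hT
    rw [← avg_const_mul]
    refine avg_mono D.bdry_continuous.norm (by fun_prop) (fun t => ?_) hT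
    rw [← Real.sqrt_sq (norm_nonneg (D.bdry t)), hsq, Real.sqrt_mul zero_le_two]
    gcongr
    exact sqrt_one_add_le (Real.neg_one_le_cos _) (Real.cos_le_one _)
  have h5 := hardyNorm_two_le hD0 hlen
  rw [h2'] at h5
  have h6 : 0 < √(2 : ℝ) := by positivity
  have h7 := hardyNorm_one_pos hD0
  have h8 : 0 < hardyRatioSup l N := by
    by_contra! h
    nlinarith
  have h9 : √2 ≤ hardyRatioSup l N * (√2 * (31 / 32)) := h5.trans (by gcongr)
  have h10 : 1 ≤ hardyRatioSup l N * (31 / 32) := by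
    by_contra! h
    nlinarith
  linarith

/-! ### Interpolation and the choice of the exponent -/

/-- An interpolation between the `p`-th and the second power. -/
theorem hardyNorm_one_interpolate (D : DirichletPolynomial l) {p X R : ℝ} (hp : 0 < p)
    (hp1 : p < 1) (hR : 0 < R) (hX : MeanLE (fun t => ‖D.bdry t‖ ^ p) X) :
    D.hardyNorm 1 ≤ R ^ (1 - p) * X + R⁻¹ * D.hardyNorm 2 ^ 2 := by
  have hc := D.bdry_continuous.norm
  have hcp : Continuous fun t => R ^ (1 - p) * ‖D.bdry t‖ ^ p :=
    continuous_const.mul (hc.rpow_const fun _ => Or.inr hp.le)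
  have hc2 : Continuous fun t => R⁻¹ * ‖D.bdry t‖ ^ 2 := continuous_const.mul (hc.pow 2)
  have h := (hX.const_mul (Real.rpow_pos_of_pos hR (1 - p))).add
    ((MeanLE.of_tendsto_avg D.tendsto_hardyNorm_two).const_mul (inv_pos.mpr hR)) hcp hc2
  refine (h.mono hc (hcp.add hc2) fun t => ?_).le_of_tendsto_avg D.tendsto_hardyNorm_one
  set x := ‖D.bdry t‖
  have hx : 0 ≤ x := norm_nonneg _
  rcases le_total x R with hxR | hxR
  · have h1 : x = x ^ (1 - p) * x ^ p := by
      rw [← Real.rpow_add_of_nonneg hx (by linarith) hp.le]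
      simp
    calc x = x ^ (1 - p) * x ^ p := h1
      _ ≤ R ^ (1 - p) * x ^ p :=
        mul_le_mul_of_nonneg_right (Real.rpow_le_rpow hx hxR (by linarith)) (by positivity)
      _ ≤ _ := le_add_of_nonneg_right (by positivity)
  · calc x ≤ R⁻¹ * x ^ 2 := by
          rw [inv_mul_eq_div, le_div_iff₀ hR, sq]
          gcongr
      _ ≤ _ := le_add_of_nonneg_left (by positivity)

/-- Here `A = ‖S_N D‖_1`, `B = ‖D‖_1`, `M = Λ_N` and `q = 1 - p`; the hypothesis is the interpolated
inequality after absorption, for every exponent. -/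
theorem le_of_interpolation {A B M : ℝ} (hA : 0 < A) (hB : 0 < B) (hM : 32 / 31 ≤ M)
    (h : ∀ q, 0 < q → q < 1 → A ≤ 2 * (2 * M ^ 2 * A) ^ q * (5 * B ^ (1 - q) / q)) :
    A ≤ 65 * (20 * Real.exp 2) ^ 2 * Real.exp 2 * Real.log M * B := by
  have hM0 : 0 < M := by linarith
  set L := Real.log M
  have hL : 1 / 32 ≤ L := by
    have h1 := Real.one_sub_inv_le_log_of_pos hM0
    have h2 : M⁻¹ ≤ 31 / 32 := by
      rw [inv_le_comm₀ hM0 (by norm_num)]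
      norm_num
      linarith
    linarith
  -- The choice gives `M ^ (2q) ≤ e²` and `1 / q = 2 + L`; the summand `2` ensures `q ≤ 1 / 2`.
  set q := (2 + L)⁻¹ with hq
  have hq0 : 0 < q := by positivity
  have hq2 : q ≤ 1 / 2 := by
    rw [hq, inv_le_comm₀ (by positivity) (by norm_num)]
    norm_num
    linarith
  have hqL : q * L ≤ 1 := by
    rw [hq, inv_mul_le_one₀ (by positivity)]
    linarith
  have hq1 : (1 : ℝ) ≤ q⁻¹ := by rw [hq, inv_inv]; linarith
  set k := 20 * Real.exp 2 with hk
  have hk1 : 1 ≤ k := by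
    have := Real.one_le_exp (x := 2) (by norm_num)
    linarith
  have h1 := h q hq0 (by linarith)
  have h2 : (2 * M ^ 2 * A) ^ q ≤ 2 * Real.exp 2 * A ^ q := by
    rw [Real.mul_rpow (by positivity) hA.le, Real.mul_rpow two_pos.le (by positivity)]
    gcongr
    · calc (2 : ℝ) ^ q ≤ 2 ^ (1 : ℝ) := by gcongr <;> linarith
        _ = 2 := Real.rpow_one 2
    · rw [Real.rpow_def_of_pos (by positivity), Real.log_pow]
      gcongr
      push_cast
      linarith
  have hAq : A = A ^ q * A ^ (1 - q) := by
    rw [← Real.rpow_add hA]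
    simp
  have h3 : A ^ (1 - q) ≤ k * q⁻¹ * B ^ (1 - q) := by
    have h4 : A ^ q * A ^ (1 - q) ≤ A ^ q * (k * q⁻¹ * B ^ (1 - q)) := by
      rw [← hAq]
      calc A ≤ 2 * (2 * M ^ 2 * A) ^ q * (5 * B ^ (1 - q) / q) := h1
        _ ≤ 2 * (2 * Real.exp 2 * A ^ q) * (5 * B ^ (1 - q) / q) := by gcongr
        _ = _ := by rw [hk]; ring
    exact le_of_mul_le_mul_left h4 (by positivity)
  have hp0 : 0 < 1 - q := by linarith
  have hpinv : (1 - q)⁻¹ ≤ 1 + 2 * q := by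
    rw [inv_le_iff_one_le_mul₀ hp0]
    nlinarith
  have h5 : A ≤ (k * q⁻¹) ^ (1 - q)⁻¹ * B := by
    have h6 := Real.rpow_le_rpow (by positivity) h3 (inv_nonneg.mpr hp0.le)
    rwa [Real.mul_rpow (by positivity) (by positivity), Real.rpow_rpow_inv hA.le hp0.ne',
      Real.rpow_rpow_inv hB.le hp0.ne'] at h6
  -- The exponent exceeds `1` by at most `2q`, which costs only a bounded factor: `(1 / q) ^ (2q) =
  -- exp (2q log (1 / q)) ≤ e²`.
  have h7 : (k * q⁻¹) ^ (1 - q)⁻¹ ≤ k ^ 2 * (q⁻¹ * Real.exp 2) := by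
    rw [Real.mul_rpow (by positivity) (by positivity)]
    gcongr
    · calc k ^ (1 - q)⁻¹ ≤ k ^ (2 : ℝ) := by
            gcongr
            linarith
        _ = k ^ 2 := Real.rpow_two k
    · calc q⁻¹ ^ (1 - q)⁻¹ ≤ q⁻¹ ^ (1 + 2 * q) := by
            gcongr
        _ = q⁻¹ * q⁻¹ ^ (2 * q) := by
            rw [Real.rpow_add (by positivity), Real.rpow_one]
        _ ≤ _ := by
            gcongr
            rw [Real.rpow_def_of_pos (by positivity)]
            gcongr
            have h8 := Real.log_le_self (x := q⁻¹) (by positivity)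
            have h9 : q⁻¹ * q = 1 := inv_mul_cancel₀ hq0.ne'
            nlinarith
  -- From `L ≥ 1 / 32` follows `2 ≤ 64 L`.
  have h10 : q⁻¹ ≤ 65 * L := by
    rw [hq, inv_inv]
    linarith
  calc A ≤ (k * q⁻¹) ^ (1 - q)⁻¹ * B := h5
    _ ≤ k ^ 2 * (q⁻¹ * Real.exp 2) * B := by gcongr
    _ ≤ k ^ 2 * (65 * L * Real.exp 2) * B := by gcongr
    _ = _ := by ring

theorem hardyNorm_cut_le (D : DirichletPolynomial l) {N : ℕ} (hN : 2 ≤ N) :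
    (D.cut N).hardyNorm 1 ≤ 65 * (20 * Real.exp 2) ^ 2 * Real.exp 2 *
      Real.log (hardyRatioSup l N) * D.hardyNorm 1 := by
  have hM := le_hardyRatioSup l hN
  set M := hardyRatioSup l N
  have hlog : 0 ≤ Real.log M := Real.log_nonneg (by linarith)
  have hD0 : 0 ≤ D.hardyNorm 1 := (norm_nonneg _).trans (D.norm_coeff_le 0)
  by_cases hS : D.cut N = 0
  · have h0 : (D.cut N).hardyNorm 1 = 0 := by
      rw [hS]
      exact norm_zero (E := DirichletPolynomial l)
    rw [h0]
    positivity
  have hA := hardyNorm_one_pos hS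
  have hB : 0 < D.hardyNorm 1 := by
    refine hardyNorm_one_pos ?_
    rintro rfl
    refine hS (Finset.sum_eq_zero fun n _ => ?_)
    rw [show (0 : DirichletPolynomial l).coeff n = 0 from map_zero _, zero_smul]
  refine le_of_interpolation hA hB hM fun q hq0 hq1 => ?_
  -- Indices start at `0`, so the last frequency kept has index `N - 1`.
  have hX := D.meanLE_cut_rpow (N - 1) (p := 1 - q) (by linarith) (by linarith)
  rw [Nat.sub_add_cancel (by omega), sub_sub_cancel] at hX
  have hM0 : 0 < M := by linarith
  -- This splitting height makes the quadratic term at most half of the left-hand side.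
  have h1 := (D.cut N).hardyNorm_one_interpolate (by linarith) (by linarith)
    (show 0 < 2 * M ^ 2 * (D.cut N).hardyNorm 1 by positivity) hX
  rw [sub_sub_cancel] at h1
  have h2 := hardyNorm_two_le hS (N := N) fun n hn => by rw [coeff_cut, if_neg (by omega)]
  have h3 : (2 * M ^ 2 * (D.cut N).hardyNorm 1)⁻¹ * (D.cut N).hardyNorm 2 ^ 2
      ≤ (D.cut N).hardyNorm 1 / 2 := by
    calc _ ≤ (2 * M ^ 2 * (D.cut N).hardyNorm 1)⁻¹ * (M * (D.cut N).hardyNorm 1) ^ 2 := by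
          gcongr
          exact (D.cut N).hardyNorm_two_nonneg
      _ = _ := by field_simp
  linarith

end DirichletPolynomial

/-! ### Passage to the completion and the theorem -/

namespace HardyOne

theorem partialSum_coe (l : Frequency) (N : ℕ) (D : DirichletPolynomial l) :
    partialSum l N (D : HardyOne l) = (D.cut N : HardyOne l) := by
  have h : (D.cut N : HardyOne l)
      = UniformSpace.Completion.toComplL (𝕜 := ℂ) (D.cut N) := rfl
  rw [h, DirichletPolynomial.cut, map_sum, partialSum, sum_apply]
  refine Finset.sum_congr rfl fun n _ => ?_
  rw [map_smul, ContinuousLinearMap.smulRight_apply, coeff_coe]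
  rfl

/-- Dirichlet polynomials are dense, and the bound is a closed condition. -/
theorem norm_partialSum_le (l : Frequency) (N : ℕ) {K : ℝ} (hK : 0 ≤ K)
    (h : ∀ D : DirichletPolynomial l, (D.cut N).hardyNorm 1 ≤ K * D.hardyNorm 1) :
    ‖partialSum l N‖ ≤ K := by
  refine ContinuousLinearMap.opNorm_le_bound _ hK fun x => ?_
  refine UniformSpace.Completion.induction_on x ?_ fun D => ?_
  · exact isClosed_le (partialSum l N).continuous.norm (continuous_const.mul continuous_norm)
  · rw [partialSum_coe, UniformSpace.Completion.norm_coe, UniformSpace.Completion.norm_coe]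
    exact h D

end HardyOne

theorem mainTheorem10 :
    ∃ C : ℝ, 0 < C ∧ ∀ (l : Frequency) (N : ℕ), 2 ≤ N →
      BddAbove (hardyRatios l N) ∧
      ‖HardyOne.partialSum l N‖ ≤ C * Real.log (hardyRatioSup l N) ∧
      ‖HardyOne.partialSum l N‖ ≤ C * Real.log N := by
  refine ⟨65 * (20 * Real.exp 2) ^ 2 * Real.exp 2, by positivity, fun l N hN => ?_⟩
  have hM := DirichletPolynomial.le_hardyRatioSup l hN
  have h0 : 0 ≤ Real.log (hardyRatioSup l N) := Real.log_nonneg (by linarith)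
  have h1 := HardyOne.norm_partialSum_le l N (by positivity) fun D => D.hardyNorm_cut_le hN
  refine ⟨DirichletPolynomial.bddAbove_hardyRatios l N, h1, h1.trans ?_⟩
  have hN' : (1 : ℝ) ≤ N := by exact_mod_cast (by omega : 1 ≤ N)
  gcongr
  refine (DirichletPolynomial.hardyRatioSup_le_sqrt l N).trans ?_
  rw [Real.sqrt_le_left (by positivity)]
  nlinarith
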